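/- Let $S$ be a finite set of points in $\mathbb{R}^2$, no three of them collinear. A (geometric) triangulation of $S$ is a plane straight-line graph with vertex set $S$ such that all of its bounded faces are triangles that jointly tile the convex hull of $S$. A convex polygon in a triangulation $T$ is a cycle of $T$ whose edges, drawn as straight-line segments, form the boundary of a convex region; let $C(T)$ be the number of convex polygons in $T$. For $n \ge 3$, let $C(n)$ be the maximum of $C(T)$ over all triangulations $T$ of all sets of $n$ points in the plane with no three points collinear. Then, as $n \to \infty$, $C(n) = O(1.50285^n)$. -/

import Mathlib

namespace GeomTriangulation

/-- The Euclidean plane. -/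
abbrev Plane : Type := EuclideanSpace ℝ (Fin 2)

/-- No three distinct points of `S` lie on a line. -/
def NoThreeCollinear (S : Finset Plane) : Prop :=
  ∀ a ∈ S, ∀ b ∈ S, ∀ c ∈ S, a ≠ b → a ≠ c → b ≠ c → ¬ Collinear ℝ ({a, b, c} : Set Plane)

/-- `G` is a plane straight-line graph with vertex set `S`: every edge joins two points of `S`, and
is drawn as the segment between them; no vertex lies in the relative interior of an edge, and the
relative interiors of distinct edges are disjoint. -/
structure IsPlaneStraightLineGraph (S : Finset Plane) (G : SimpleGraph Plane) : Prop where
  mem_of_adj : ∀ a b, G.Adj a b → a ∈ S ∧ b ∈ S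
  vertex_notMem : ∀ a b, G.Adj a b → ∀ c ∈ S, c ∉ openSegment ℝ a b
  noncrossing : ∀ a b c d, G.Adj a b → G.Adj c d → s(a, b) ≠ s(c, d) →
    Disjoint (openSegment ℝ a b) (openSegment ℝ c d)

/-- The point set drawn by the graph: its vertices and the segments that are its edges. -/
def drawing (S : Finset Plane) (G : SimpleGraph Plane) : Set Plane :=
  {x | x ∈ S ∨ ∃ a b, G.Adj a b ∧ x ∈ segment ℝ a b}

/-- The bounded faces: the bounded connected components of the complement of the drawing. -/
def IsBoundedFace (S : Finset Plane) (G : SimpleGraph Plane) (f : Set Plane) : Prop :=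
  (∃ x, x ∉ drawing S G ∧ f = connectedComponentIn (drawing S G)ᶜ x) ∧ Bornology.IsBounded f

/-- A (geometric) triangulation of `S`: a plane straight-line graph with vertex set `S` all of
whose bounded faces are triangles, which jointly tile the convex hull of `S`. (Distinct faces are
disjoint by definition, so tiling means that the closed faces cover exactly the hull.) -/
structure IsTriangulation (S : Finset Plane) (G : SimpleGraph Plane) : Prop
    extends IsPlaneStraightLineGraph S G where
  face_triangle : ∀ f, IsBoundedFace S G f →
    ∃ a b c, G.Adj a b ∧ G.Adj b c ∧ G.Adj c a ∧
      f = interior (convexHull ℝ ({a, b, c} : Set Plane))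
  tile : (⋃ f ∈ {f | IsBoundedFace S G f}, closure f) = convexHull ℝ (S : Set Plane)

/-- A convex polygon in `G`: a subgraph of `G` that is a cycle and whose edges, drawn as segments,
form precisely the boundary of the convex hull of its vertices. -/
def IsConvexPolygon {G : SimpleGraph Plane} (H : G.Subgraph) : Prop :=
  (∃ (v : Plane) (w : G.Walk v v), w.IsCycle ∧ w.toSubgraph = H) ∧
    {x | ∃ a b, H.Adj a b ∧ x ∈ segment ℝ a b} = frontier (convexHull ℝ H.verts)

/-- The number of convex polygons in `G`. -/
noncomputable def numConvexPolygons (G : SimpleGraph Plane) : ℕ :=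
  Set.ncard {H : G.Subgraph | IsConvexPolygon H}

/-- The numbers of convex polygons in the triangulations of `n` points in the plane, no three of
them collinear. -/
def convexPolygonCounts (n : ℕ) : Set ℕ :=
  {k | ∃ (S : Finset Plane) (G : SimpleGraph Plane), S.card = n ∧ NoThreeCollinear S ∧
    IsTriangulation S G ∧ numConvexPolygons G = k}

/-- The maximum number of convex polygons in a triangulation of `n` points in the plane. -/
noncomputable def maxConvexPolygons (n : ℕ) : ℕ := sSup (convexPolygonCounts n)

end GeomTriangulation

/-! A convex polygon is charged to one of its edges `q p`, directed with the polygon on its left;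
there are at most n² such pairs, so it suffices to bound the polygons on a fixed base by b^n for
some b < 1.50285. Place a viewpoint `m` just outside the midpoint of the base. The rest of the
boundary, from `p` to `q`, turns only left and advances in angle around `m` (`IsBoundary.isCap`). So
the task is to count left-turning paths, or caps, in an acyclic graph whose edges are directed by
angle around `m`.

The count is made by sweeping a front, an angularly monotone path of edges, outward from the base
(`hasPotential_of_isFront`). A front carries a potential `Ψ` whose ratios bound the numbers of caps
between front vertices that use edges on or above the front. Each front edge has a size `n`, and
across it `Ψ` grows by at most a factor `g n`. Let `w` be the apex of the face beyond a front edge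
`u v`.

If `w` lies in the angle of `u v`, the front advances to `u w v`. Returning the edge `u v` adds 1 to
the ratio across it, so `g` must satisfy g(m) g(n) + 1 ≤ g(m+n). If no front edge has such an apex
and none is a hull edge, each apex lies to one side of its edge's angle. Then either an end vertex
of the front has a single edge, or two consecutive edges `u v`, `v x` share the face `u v x`. In the
latter case a cap through `v` would turn right, so `v` can be bypassed at the cost of one unit of
size. A hull edge of the front splits the problem in two. The total size stays below the number of
vertices.

The extremal recursion gives 1, 2, 3, 5, 7, 11, …; along powers of two it is a ↦ a² + 1, that is 1,
2, 5, 26, 677, …, with growth rate 1.50283…. The base 1.502845 lies just above this rate and leaves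
room below 1.50285 for the factor n². -/

namespace GeomTriangulation

/-! ### Caps in acyclic directed graphs -/

section Caps

variable {V : Type*}

/-- A directed path from `i` to `j` along `E`, all of whose consecutive triples satisfy `turn`. -/
structure IsCap (turn : V → V → V → Prop) (E : V → V → Prop) (i j : V) (l : List V) : Prop where
  head : ∃ t, l = i :: t
  last : ∃ t, l = t ++ [j]
  chain : l.IsChain E
  turns : ∀ x a b c y, l = x ++ a :: b :: c :: y → turn a b c

/-- There are at most `c` caps from `i` to `j`. -/
def CapBound (turn : V → V → V → Prop) (E : V → V → Prop) (i j : V) (c : ℝ) : Prop :=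
  ∀ Q : Finset (List V), (∀ l ∈ Q, IsCap turn E i j l) → (Q.card : ℝ) ≤ c

variable {turn : V → V → V → Prop} {E E' : V → V → Prop} {ρ : V → ℝ} {i j u v w x : V}
  {l : List V} {c c₁ c₂ c₃ : ℝ}

theorem IsCap.prefix {a b : List V} (h : IsCap turn E i j (a ++ u :: b)) :
    IsCap turn E i u (a ++ [u]) where
  head := by
    obtain ⟨t, ht⟩ := h.head
    cases a with
    | nil => simp at ht; exact ⟨[], by simp [ht.1]⟩
    | cons y ys => simp at ht; exact ⟨ys ++ [u], by simp [ht.1]⟩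
  last := ⟨a, rfl⟩
  chain := (List.isChain_split.1 h.chain).1
  turns := by
    intro x p q r y hy
    refine h.turns x p q r (y ++ b) ?_
    have := congrArg (· ++ b) hy
    simpa using this

theorem IsCap.suffix {a b : List V} (h : IsCap turn E i j (a ++ u :: b)) :
    IsCap turn E u j (u :: b) where
  head := ⟨b, rfl⟩
  last := by
    obtain ⟨t, ht⟩ := h.last
    rcases List.eq_nil_or_concat b with rfl | ⟨b', z, rfl⟩
    · refine ⟨[], ?_⟩
      have := (List.append_inj' ht (by simp)).2
      simpa using this
    · refine ⟨u :: b', ?_⟩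
      have h2 : (a ++ u :: b') ++ [z] = t ++ [j] := by simpa using ht
      have := (List.append_inj' h2 (by simp)).2
      simpa using this
  chain := (List.isChain_split.1 h.chain).2
  turns := by
    intro x p q r y hy
    exact h.turns (a ++ x) p q r y (by simp [hy])

theorem IsCap.mono_of_rel (h : IsCap turn E i j l)
    (hE : ∀ a b s t, l = s ++ a :: b :: t → E a b → E' a b) : IsCap turn E' i j l where
  head := h.head
  last := h.last
  turns := h.turns
  chain := by
    rw [List.isChain_iff_forall_rel_of_append_cons_cons]
    intro a b s t hl
    exact hE a b s t hl ((List.isChain_iff_forall_rel_of_append_cons_cons.1 h.chain) hl)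

theorem IsCap.pairwise (h : IsCap turn E i j l) (hρ : ∀ y z, E y z → ρ y < ρ z) :
    l.Pairwise (fun a b => ρ a < ρ b) := by
  have hc : l.IsChain (fun a b => ρ a < ρ b) := h.chain.imp (fun a b hab => hρ a b hab)
  have : Trans (fun a b : V => ρ a < ρ b) (fun a b : V => ρ a < ρ b)
    (fun a b : V => ρ a < ρ b) := ⟨fun h1 h2 => lt_trans h1 h2⟩
  exact hc.pairwise

theorem IsCap.le_of_mem (h : IsCap turn E i j l) (hρ : ∀ y z, E y z → ρ y < ρ z) (hx : x ∈ l) :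
    ρ i ≤ ρ x ∧ ρ x ≤ ρ j := by
  have hp := h.pairwise hρ
  constructor
  · obtain ⟨t, rfl⟩ := h.head
    rcases List.mem_cons.1 hx with rfl | hx
    · exact le_rfl
    · exact ((List.pairwise_cons.1 hp).1 x hx).le
  · obtain ⟨t, rfl⟩ := h.last
    rcases List.mem_append.1 hx with hx | hx
    · exact ((List.pairwise_append.1 hp).2.2 x hx j (by simp)).le
    · simp at hx; simp [hx]

theorem CapBound.of_injOn {E₁ : V → V → Prop} {i₁ j₁ : V} (h : CapBound turn E₁ i₁ j₁ c)
    (f : List V → List V) (hf : ∀ l, IsCap turn E i j l → IsCap turn E₁ i₁ j₁ (f l))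
    (hinj : ∀ l l', IsCap turn E i j l → IsCap turn E i j l' → f l = f l' → l = l') :
    CapBound turn E i j c := by
  classical
  intro Q hQ
  have := h (Q.image f) (by
    intro l hl
    obtain ⟨l', hl', rfl⟩ := Finset.mem_image.1 hl
    exact hf _ (hQ _ hl'))
  rwa [Finset.card_image_of_injOn] at this
  intro a ha b hb hab
  exact hinj a b (hQ a ha) (hQ b hb) hab

theorem CapBound.of_imp (h : CapBound turn E' i j c)
    (hE : ∀ l, IsCap turn E i j l → IsCap turn E' i j l) : CapBound turn E i j c :=
  h.of_injOn id hE (fun _ _ _ _ h => h)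

theorem CapBound.mono (h : CapBound turn E i j c) (hc : c ≤ c₁) : CapBound turn E i j c₁ :=
  fun Q hQ => (h Q hQ).trans hc

theorem CapBound.refl (hρ : ∀ y z, E y z → ρ y < ρ z) : CapBound turn E i i 1 := by
  intro Q hQ
  have : Q ⊆ {[i]} := by
    intro l hl
    have h := hQ l hl
    obtain ⟨t, rfl⟩ := h.head
    cases t with
    | nil => simp
    | cons y t =>
      have h1 := (List.isChain_cons_cons.1 h.chain).1
      have h2 := (h.le_of_mem hρ (x := y) (by simp)).2
      exact absurd (hρ _ _ h1) (not_lt.2 h2)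
  have := Finset.card_le_card this
  simpa using this

theorem exists_of_not_isChain_removed (h : IsCap turn E i j l)
    (hE : ∀ y z, E y z → E' y z ∨ (y = u ∧ z = v)) (hl : ¬ IsCap turn E' i j l) :
    ∃ s t, l = s ++ u :: v :: t := by
  by_contra hcon
  push Not at hcon
  refine hl (h.mono_of_rel ?_)
  intro a b s t hst hab
  rcases hE a b hab with h1 | ⟨rfl, rfl⟩
  · exact h1
  · exact absurd hst (hcon s t)

/-- Ranks increase along a path, so one that ends before `v` or starts after `u` cannot use the edge
`u v`. -/
theorem CapBound.of_not_between (hρ : ∀ y z, E y z → ρ y < ρ z) (h : CapBound turn E' i j c)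
    (hE : ∀ y z, E y z → E' y z ∨ (y = u ∧ z = v)) (hij : ρ j < ρ v ∨ ρ u < ρ i) :
    CapBound turn E i j c := by
  refine h.of_imp fun l hl => ?_
  by_contra hcon
  obtain ⟨s, t, rfl⟩ := exists_of_not_isChain_removed hl hE hcon
  have hu := (hl.le_of_mem hρ (x := u) (by simp)).1
  have hv := (hl.le_of_mem hρ (x := v) (by simp)).2
  rcases hij with h | h <;> linarith

/-- A cap through `u v` uses it once, since ranks increase, and is determined by its part up to `u`
and its part from `v`. The turning conditions at `u` and `v` that involve the edge are dropped, so
the product is only an upper bound. -/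
theorem CapBound.add_edge (hρ : ∀ y z, E y z → ρ y < ρ z)
    (hE : ∀ y z, E y z → E' y z ∨ (y = u ∧ z = v))
    (h₁ : CapBound turn E' i j c₁) (h₂ : CapBound turn E' i u c₂) (h₃ : CapBound turn E' v j c₃)
    (hc : 0 ≤ c₂) : CapBound turn E i j (c₁ + c₂ * c₃) := by
  classical
  intro Q hQ
  rw [← Finset.card_filter_add_card_filter_not (s := Q) (fun l => IsCap turn E' i j l)]
  push_cast
  refine add_le_add (h₁ _ fun l hl => (Finset.mem_filter.1 hl).2) ?_
  set R := Q.filter (fun l => ¬ IsCap turn E' i j l) with hR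
  have hdec : ∀ l ∈ R, ∃ st : List V × List V, l = st.1 ++ u :: v :: st.2 := by
    intro l hl
    obtain ⟨h1, h2⟩ := Finset.mem_filter.1 hl
    obtain ⟨s, t, h⟩ := exists_of_not_isChain_removed (hQ l h1) hE h2
    exact ⟨(s, t), h⟩
  choose! f hf using hdec
  have hcap : ∀ l ∈ R, IsCap turn E i j l := fun l hl => hQ l (Finset.mem_filter.1 hl).1
  have hleft : ∀ l ∈ R, IsCap turn E' i u ((f l).1 ++ [u]) := by
    intro l hl
    have h := hcap l hl
    rw [hf l hl] at h
    have h' := h.prefix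
    refine h'.mono_of_rel ?_
    intro a b s t hst hab
    rcases hE a b hab with h1 | ⟨rfl, rfl⟩
    · exact h1
    · have := (h'.le_of_mem hρ (x := b) (by rw [hst]; simp)).2
      exact absurd (hρ _ _ hab) (not_lt.2 this)
  have hright : ∀ l ∈ R, IsCap turn E' v j (v :: (f l).2) := by
    intro l hl
    have h := hcap l hl
    rw [hf l hl] at h
    have h' : IsCap turn E v j (v :: (f l).2) :=
      IsCap.suffix (a := (f l).1 ++ [u]) (i := i) (by simpa using h)
    refine h'.mono_of_rel ?_
    intro a b s t hst hab
    rcases hE a b hab with h1 | ⟨rfl, rfl⟩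
    · exact h1
    · have := (h'.le_of_mem hρ (x := a) (by rw [hst]; simp)).1
      exact absurd (hρ _ _ hab) (not_lt.2 this)
  have hinj : Set.InjOn f R := by
    intro a ha b hb hab
    rw [hf a ha, hf b hb, hab]
  have hsub : R.image f ⊆ (R.image fun l => (f l).1) ×ˢ (R.image fun l => (f l).2) := by
    intro p hp
    obtain ⟨l, hl, rfl⟩ := Finset.mem_image.1 hp
    exact Finset.mem_product.2 ⟨Finset.mem_image_of_mem (fun l => (f l).1) hl,
      Finset.mem_image_of_mem (fun l => (f l).2) hl⟩
  have hcard := Finset.card_le_card hsub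
  rw [Finset.card_image_of_injOn hinj, Finset.card_product] at hcard
  have hA := h₂ ((R.image fun l => (f l).1).image (· ++ [u])) (by
    intro l hl
    simp only [Finset.mem_image] at hl
    obtain ⟨_, ⟨l, hl, rfl⟩, rfl⟩ := hl
    exact hleft l hl)
  have hB := h₃ ((R.image fun l => (f l).2).image (v :: ·)) (by
    intro l hl
    simp only [Finset.mem_image] at hl
    obtain ⟨_, ⟨l, hl, rfl⟩, rfl⟩ := hl
    exact hright l hl)
  rw [Finset.card_image_of_injective _ (List.append_left_injective [u])] at hA
  rw [Finset.card_image_of_injective _ (List.cons_injective)] at hB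
  calc (R.card : ℝ) ≤ ((R.image fun l => (f l).1).card : ℝ) * (R.image fun l => (f l).2).card := by
        exact_mod_cast hcard
    _ ≤ c₂ * c₃ := mul_le_mul hA hB (by positivity) hc

/-- A path that starts at rank at most `ρ u` can never leave that range. -/
theorem CapBound.of_forall_not_crossing (hi : ρ i ≤ ρ u)
    (hj : ρ v ≤ ρ j) (huv : ρ u < ρ v) (hE : ∀ y z, E y z → ρ z ≤ ρ u ∨ ρ v ≤ ρ y) :
    CapBound turn E i j 0 := by
  intro Q hQ
  suffices Q = ∅ by simp [this]
  rw [Finset.eq_empty_iff_forall_notMem]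
  intro l hl
  have h := hQ l hl
  obtain ⟨t, ht⟩ := h.head
  have hall : ∀ (t : List V) (i : V), (i :: t).IsChain E → ρ i ≤ ρ u → ∀ y ∈ i :: t, ρ y ≤ ρ u := by
    intro t
    induction t with
    | nil => intro i _ hi y hy; simp at hy; rwa [hy]
    | cons z t ih =>
      intro i hc hi y hy
      rw [List.isChain_cons_cons] at hc
      rcases List.mem_cons.1 hy with rfl | hy
      · exact hi
      · refine ih z hc.2 ?_ y hy
        rcases hE _ _ hc.1 with h | h
        · exact h
        · linarith
  obtain ⟨t', ht'⟩ := h.last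
  have := hall t i (ht ▸ h.chain) hi j (by rw [← ht, ht']; simp)
  linarith

/-- A cap with `v` as an inner vertex would contain the forbidden turn `u v x`, so every cap avoids
`v`. -/
theorem CapBound.of_bypass (hin : ∀ y, E y v → y = u) (hout : ∀ z, E v z → z = x)
    (hturn : ¬ turn u v x) (hi : i ≠ v) (hj : j ≠ v)
    (hE : ∀ y z, E y z → y ≠ v → z ≠ v → E' y z) (h : CapBound turn E' i j c) :
    CapBound turn E i j c := by
  refine h.of_imp fun l hl => hl.mono_of_rel ?_
  have hv : v ∉ l := by
    intro hv
    obtain ⟨s, t, rfl⟩ := List.append_of_mem hv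
    rcases List.eq_nil_or_concat s with rfl | ⟨s, a, rfl⟩
    · obtain ⟨t', ht'⟩ := hl.head
      simp at ht'
      exact hi ht'.1.symm
    cases t with
    | nil =>
      obtain ⟨t', ht'⟩ := hl.last
      have := (List.append_inj' ht' (by simp)).2
      simp at this
      exact hj this.symm
    | cons b t =>
      have hc := List.isChain_iff_forall_rel_of_append_cons_cons.1 hl.chain
      have h1 : E a v := @hc a v s (b :: t) (by simp)
      have h2 : E v b := @hc v b (s ++ [a]) t (by simp)
      have h3 := hl.turns s a v b t (by simp)
      rw [hin a h1, hout b h2] at h3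
      exact hturn h3
  intro a b s t hst hab
  refine hE a b hab ?_ ?_
  · rintro rfl; exact hv (by rw [hst]; simp)
  · rintro rfl; exact hv (by rw [hst]; simp)

theorem CapBound.of_unique_in (hin : ∀ y, E y v → y = u) (hi : i ≠ v)
    (h : CapBound turn E i u c) : CapBound turn E i v c := by
  have key : ∀ l, IsCap turn E i v l → ∃ s, l = s ++ [u] ++ [v] := by
    intro l hl
    obtain ⟨t, rfl⟩ := hl.last
    rcases List.eq_nil_or_concat t with rfl | ⟨s, a, rfl⟩
    · obtain ⟨t', ht'⟩ := hl.head
      simp at ht'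
      exact absurd ht'.1.symm hi
    · have hc := List.isChain_iff_forall_rel_of_append_cons_cons.1 hl.chain
      have h1 : E a v := @hc a v s [] (by simp)
      exact ⟨s, by simp [hin a h1]⟩
  refine h.of_injOn List.dropLast ?_ ?_
  · intro l hl
    obtain ⟨s, rfl⟩ := key l hl
    rw [List.dropLast_concat]
    exact IsCap.prefix (b := [v]) (by simpa using hl)
  · intro l l' hl hl' he
    obtain ⟨s, rfl⟩ := key l hl
    obtain ⟨s', rfl⟩ := key l' hl'
    simpa using he

theorem CapBound.of_unique_out (hout : ∀ z, E v z → z = x) (hj : j ≠ v)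
    (h : CapBound turn E x j c) : CapBound turn E v j c := by
  have key : ∀ l, IsCap turn E v j l → ∃ s, l = v :: x :: s := by
    intro l hl
    obtain ⟨t, rfl⟩ := hl.head
    cases t with
    | nil =>
      obtain ⟨t', ht'⟩ := hl.last
      have := (List.append_inj' (s₁ := []) (t₁ := [v]) ht' (by simp)).2
      simp at this
      exact absurd this.symm hj
    | cons a s =>
      have h1 := (List.isChain_cons_cons.1 hl.chain).1
      exact ⟨s, by simp [hout a h1]⟩
  refine h.of_injOn List.tail ?_ ?_
  · intro l hl
    obtain ⟨s, rfl⟩ := key l hl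
    exact IsCap.suffix (a := [v]) hl
  · intro l l' hl hl' he
    obtain ⟨s, rfl⟩ := key l hl
    obtain ⟨s', rfl⟩ := key l' hl'
    simpa using he

end Caps

/-! ### Potentials along a front -/

section Potential

variable {V : Type*}

/-- A potential on the front `F`: ratios of `Ψ` bound the numbers of caps between front vertices,
and along an edge of the front of size `n`, as measured by `σ`, the ratio is at most `g n`. -/
structure IsPotential (turn : V → V → V → Prop) (ρ : V → ℝ) (g : ℕ → ℝ) (E : V → V → Prop)
    (F : List V) (N : ℤ) (Ψ : V → ℝ) (σ : V → ℤ) : Prop where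
  pos : ∀ v ∈ F, 0 < Ψ v
  step : F.IsChain fun u v => ∃ n : ℕ, 1 ≤ n ∧ σ v = σ u + n ∧ Ψ u ≤ Ψ v ∧ Ψ v ≤ g n * Ψ u
  count : ∀ i ∈ F, ∀ j ∈ F, ρ i ≤ ρ j → CapBound turn E i j (Ψ j / Ψ i)
  total : ∀ i ∈ F, ∀ j ∈ F, σ j + 1 ≤ σ i + N

/-- A front that carries a potential of total size less than `N`. -/
def HasPotential (turn : V → V → V → Prop) (ρ : V → ℝ) (g : ℕ → ℝ) (E : V → V → Prop)
    (F : List V) (N : ℤ) : Prop :=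
  ∃ Ψ σ, IsPotential turn ρ g E F N Ψ σ

variable {turn : V → V → V → Prop} {E E' : V → V → Prop} {ρ : V → ℝ} {g : ℕ → ℝ} {u v w x : V}
  {s t : List V} {N N₁ N₂ : ℤ}

theorem HasPotential.mono (h : HasPotential turn ρ g E s N) (hN : N ≤ N₁) :
    HasPotential turn ρ g E s N₁ := by
  obtain ⟨Ψ, σ, h⟩ := h
  exact ⟨Ψ, σ, h.pos, h.step, h.count, fun i hi j hj => by have := h.total i hi j hj; omega⟩

theorem hasPotential_singleton (hρ : ∀ y z, E y z → ρ y < ρ z) :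
    HasPotential turn ρ g E [v] 1 := by
  refine ⟨fun _ => 1, fun _ => 0, by simp, by simp, ?_, by simp⟩
  intro i hi j hj _
  simp only [List.mem_singleton] at hi hj
  subst hi; subst hj
  simpa using CapBound.refl hρ

theorem sorted_split (hF : (s ++ u :: v :: t).Pairwise fun a b => ρ a < ρ b) :
    (∀ z ∈ s ++ [u], ρ z ≤ ρ u) ∧ ρ u < ρ v ∧ (∀ z ∈ v :: t, ρ v ≤ ρ z) := by
  rw [List.pairwise_append, List.pairwise_cons, List.pairwise_cons] at hF
  obtain ⟨_, ⟨h1, h2, _⟩, h3⟩ := hF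
  refine ⟨?_, h1 v (by simp), ?_⟩
  · intro z hz
    rcases List.mem_append.1 hz with hz | hz
    · exact (h3 z hz u (by simp)).le
    · simp at hz; rw [hz]
  · intro z hz
    rcases List.mem_cons.1 hz with rfl | hz
    · exact le_rfl
    · exact (h2 z hz).le

theorem mem_split_iff {z : V} : z ∈ s ++ u :: v :: t ↔ z ∈ s ++ [u] ∨ z ∈ v :: t := by
  simp [or_assoc]

/-- The old caps and those through `u v` together number at most Ψj/Ψi + (Ψu/Ψi)(Ψj/Ψv). This equals
(Ψj/Ψi)(1 + Ψu/Ψv), again a ratio once `Ψ` is rescaled to the right of `u`. Across `u v` the ratio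
rises by exactly 1, which is where the inequality for `g` enters. -/
theorem HasPotential.add_edge (hρ : ∀ y z, E y z → ρ y < ρ z)
    (hg : ∀ m n : ℕ, 1 ≤ m → 1 ≤ n → g m * g n + 1 ≤ g (m + n))
    (hF : (s ++ u :: v :: t).Pairwise fun a b => ρ a < ρ b)
    (hE : ∀ y z, E y z → E' y z ∨ (y = u ∧ z = v))
    (h : HasPotential turn ρ g E' (s ++ u :: w :: v :: t) N) :
    HasPotential turn ρ g E (s ++ u :: v :: t) N := by
  obtain ⟨Ψ, σ, h⟩ := h
  obtain ⟨hs, huv, ht⟩ := sorted_split hF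
  have hms : ∀ z ∈ s ++ [u], z ∈ s ++ u :: w :: v :: t := fun z hz => by
    simp only [List.mem_append, List.mem_cons, List.not_mem_nil, or_false] at hz ⊢
    tauto
  have hmt : ∀ z ∈ v :: t, z ∈ s ++ u :: w :: v :: t := fun z hz => by
    simp only [List.mem_append, List.mem_cons] at hz ⊢
    tauto
  have hu := h.pos u (hms u (by simp))
  have hv := h.pos v (hmt v (by simp))
  have hw := h.pos w (by simp)
  obtain ⟨hc1, ⟨n₁, hn₁, hσ₁, hΨ₁, hg₁⟩, hc2⟩ := List.isChain_append_cons_cons.1 h.step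
  obtain ⟨⟨n₂, hn₂, hσ₂, hΨ₂, hg₂⟩, hc3⟩ := List.isChain_cons_cons.1 hc2
  -- This factor is chosen so that `Ψ v * κ = Ψ v + Ψ u`.
  set κ := 1 + Ψ u / Ψ v with hκ
  have hκ1 : 1 ≤ κ := by rw [hκ]; have := div_pos hu hv; linarith
  have hκ0 : 0 < κ := by linarith
  refine ⟨fun z => if ρ z ≤ ρ u then Ψ z else Ψ z * κ, σ, ?_, ?_, ?_, ?_⟩
  · intro z hz
    have : 0 < Ψ z := by
      rcases mem_split_iff.1 hz with hz | hz
      · exact h.pos z (hms z hz)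
      · exact h.pos z (hmt z hz)
    split_ifs
    · exact this
    · positivity
  · refine List.isChain_append_cons_cons.2 ⟨?_, ?_, ?_⟩
    · refine hc1.imp_of_mem_imp fun a b ha hb hab => ?_
      simpa [hs a ha, hs b hb] using hab
    · refine ⟨n₁ + n₂, by omega, by push_cast; omega, ?_, ?_⟩
      · simp only [le_refl, if_true, not_le.2 huv, if_false]
        nlinarith
      · simp only [le_refl, if_true, not_le.2 huv, if_false]
        have h1 : Ψ v * κ = Ψ v + Ψ u := by rw [hκ]; field_simp
        rw [h1]
        have h2 := hg n₁ n₂ hn₁ hn₂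
        have hg2 : 0 ≤ g n₂ := by
          by_contra hneg
          push Not at hneg
          nlinarith
        calc Ψ v + Ψ u ≤ g n₂ * (g n₁ * Ψ u) + Ψ u := by
              have := mul_le_mul_of_nonneg_left hg₁ hg2
              linarith
          _ = (g n₁ * g n₂ + 1) * Ψ u := by ring
          _ ≤ _ := mul_le_mul_of_nonneg_right h2 hu.le
    · refine hc3.imp_of_mem_imp fun a b ha hb hab => ?_
      have ha' := not_le.2 (huv.trans_le (ht a ha))
      have hb' := not_le.2 (huv.trans_le (ht b hb))
      simp only [ha', hb', if_false]
      obtain ⟨n, hn, h1, h2, h3⟩ := hab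
      exact ⟨n, hn, h1, by gcongr, by rw [← mul_assoc]; gcongr⟩
  · intro i hi j hj hij
    replace hi := mem_split_iff.1 hi
    replace hj := mem_split_iff.1 hj
    rcases hi with hi | hi <;> rcases hj with hj | hj
    · simp only [hs i hi, hs j hj, if_true]
      exact (h.count i (hms i hi) j (hms j hj) hij).of_not_between hρ hE
        (Or.inl ((hs j hj).trans_lt huv))
    · have hj' := not_le.2 (huv.trans_le (ht j hj))
      simp only [hs i hi, hj', if_true, if_false]
      have := CapBound.add_edge hρ hE (h.count i (hms i hi) j (hmt j hj) hij)
        (h.count i (hms i hi) u (hms u (by simp)) (hs i hi))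
        (h.count v (hmt v (by simp)) j (hmt j hj) (ht j hj))
        (div_nonneg hu.le (h.pos i (hms i hi)).le)
      refine this.mono (le_of_eq ?_)
      have hi0 := h.pos i (hms i hi)
      rw [hκ]
      field_simp
    · have := hs j hj
      have := ht i hi
      linarith
    · have hi' := not_le.2 (huv.trans_le (ht i hi))
      have hj' := not_le.2 (huv.trans_le (ht j hj))
      simp only [hi', hj', if_false]
      rw [mul_div_mul_right _ _ hκ0.ne']
      exact (h.count i (hmt i hi) j (hmt j hj) hij).of_not_between hρ hE
        (Or.inr (huv.trans_le (ht i hi)))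
  · intro i hi j hj
    refine h.total i ?_ j ?_
    · exact (mem_split_iff.1 hi).elim (hms i) (hmt i)
    · exact (mem_split_iff.1 hj).elim (hms j) (hmt j)

/-- The vertex `v` takes over the value `Ψ u`: caps ending at `v` come from `u`, and caps starting
at `v` continue to `x`, where `Ψ x ≥ Ψ u`. The edge `u v` gets size 1, `v x` inherits the size of `u
x`, and `σ` shifts by 1 beyond `u`. -/
theorem HasPotential.bypass (hρ : ∀ y z, E y z → ρ y < ρ z) (hg : 1 ≤ g 1)
    (hF : (s ++ u :: v :: x :: t).Pairwise fun a b => ρ a < ρ b)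
    (hin : ∀ y, E y v → y = u) (hout : ∀ z, E v z → z = x) (hturn : ¬ turn u v x)
    (hE : ∀ y z, E y z → y ≠ v → z ≠ v → E' y z)
    (h : HasPotential turn ρ g E' (s ++ u :: x :: t) N) :
    HasPotential turn ρ g E (s ++ u :: v :: x :: t) (N + 1) := by
  classical
  obtain ⟨Ψ, σ, h⟩ := h
  obtain ⟨hs, huv, ht⟩ := sorted_split hF
  have hvx : ρ v < ρ x := (sorted_split (s := s ++ [u]) (by simpa using hF)).2.1
  have ht' : ∀ z ∈ x :: t, ρ x ≤ ρ z :=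
    (sorted_split (s := s ++ [u]) (by simpa using hF)).2.2
  have hms : ∀ z ∈ s ++ [u], z ∈ s ++ u :: x :: t := fun z hz => mem_split_iff.2 (Or.inl hz)
  have hmt : ∀ z ∈ x :: t, z ∈ s ++ u :: x :: t := fun z hz => mem_split_iff.2 (Or.inr hz)
  have hmem : ∀ z ∈ s ++ u :: v :: x :: t, z ∈ s ++ [u] ∨ z = v ∨ z ∈ x :: t := fun z hz => by
    simp only [List.mem_append, List.mem_cons, List.not_mem_nil, or_false] at hz ⊢
    tauto
  have hsv : ∀ z ∈ s ++ [u], z ≠ v := by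
    rintro z hz rfl
    exact absurd (hs z hz) (not_le.2 huv)
  have htv : ∀ z ∈ x :: t, z ≠ v := by
    rintro z hz rfl
    exact absurd (ht' z hz) (not_le.2 hvx)
  have htu : ∀ z ∈ x :: t, ¬ ρ z ≤ ρ u := fun z hz =>
    not_le.2 (huv.trans (hvx.trans_le (ht' z hz)))
  have hu := h.pos u (hms u (by simp))
  have hx := h.pos x (hmt x (by simp))
  obtain ⟨hc1, ⟨n, hn, hσ, hΨ, hgn⟩, hc2⟩ := List.isChain_append_cons_cons.1 h.step
  refine ⟨fun z => if z = v then Ψ u else Ψ z,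
    fun z => if z = v then σ u + 1 else if ρ z ≤ ρ u then σ z else σ z + 1, ?_, ?_, ?_, ?_⟩
  · intro z hz
    rcases hmem z hz with hz | rfl | hz
    · simpa [hsv z hz] using h.pos z (hms z hz)
    · simpa using hu
    · simpa [htv z hz] using h.pos z (hmt z hz)
  · refine List.isChain_append_cons_cons.2 ⟨?_, ?_, List.isChain_cons_cons.2 ⟨?_, ?_⟩⟩
    · refine hc1.imp_of_mem_imp fun a b ha hb hab => ?_
      simpa [hs a ha, hs b hb, hsv a ha, hsv b hb] using hab
    · refine ⟨1, le_rfl, ?_, ?_, ?_⟩ <;> simp only [hsv u (by simp), if_true, if_false, le_refl]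
      · simp
      · nlinarith
    · refine ⟨n, hn, ?_, ?_, ?_⟩ <;>
        simp only [htv x (by simp), htu x (by simp), if_true, if_false]
      · omega
      · exact hΨ
      · exact hgn
    · refine hc2.imp_of_mem_imp fun a b ha hb hab => ?_
      simp only [htv a ha, htv b hb, htu a ha, htu b hb, if_false]
      obtain ⟨n, hn, h1, h2⟩ := hab
      exact ⟨n, hn, by omega, h2⟩
  · have hby : ∀ i ∈ s ++ u :: x :: t, ∀ j ∈ s ++ u :: x :: t, i ≠ v → j ≠ v → ρ i ≤ ρ j →
        CapBound turn E i j (Ψ j / Ψ i) := fun i hi j hj hiv hjv hij =>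
      (h.count i hi j hj hij).of_bypass hin hout hturn hiv hjv hE
    intro i hi j hj hij
    replace hi := hmem i hi
    replace hj := hmem j hj
    rcases hi with hi | rfl | hi <;> rcases hj with hj | rfl | hj
    · simp only [hsv i hi, hsv j hj, if_false]
      exact hby i (hms i hi) j (hms j hj) (hsv i hi) (hsv j hj) hij
    · simp only [hsv i hi, if_true, if_false]
      exact (hby i (hms i hi) u (hms u (by simp)) (hsv i hi) (hsv u (by simp))
        (hs i hi)).of_unique_in hin (hsv i hi)
    · simp only [hsv i hi, htv j hj, if_false]
      exact hby i (hms i hi) j (hmt j hj) (hsv i hi) (htv j hj) hij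
    · have := hs j hj
      linarith
    · simp only [if_true]
      rw [div_self hu.ne']
      exact CapBound.refl hρ
    · simp only [htv j hj, if_true, if_false]
      refine CapBound.mono ((hby x (hmt x (by simp)) j (hmt j hj) (htv x (by simp)) (htv j hj)
        (ht' j hj)).of_unique_out hout (htv j hj)) ?_
      have := h.pos j (hmt j hj)
      gcongr
    · have := hs j hj
      have := ht' i hi
      linarith
    · have := ht' i hi
      linarith
    · simp only [htv i hi, htv j hj, if_false]
      exact hby i (hmt i hi) j (hmt j hj) (htv i hi) (htv j hj) hij
  · intro i hi j hj
    have h1 : ∀ z ∈ s ++ u :: x :: t, z ≠ v → σ z ≤ (if z = v then σ u + 1 else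
        if ρ z ≤ ρ u then σ z else σ z + 1) ∧ (if z = v then σ u + 1 else
        if ρ z ≤ ρ u then σ z else σ z + 1) ≤ σ z + 1 := by
      intro z _ hzv
      simp only [hzv, if_false]
      split_ifs <;> omega
    have h2 : ∀ z ∈ s ++ u :: v :: x :: t, ∃ z' ∈ s ++ u :: x :: t,
        σ z' ≤ (if z = v then σ u + 1 else if ρ z ≤ ρ u then σ z else σ z + 1) ∧
        (if z = v then σ u + 1 else if ρ z ≤ ρ u then σ z else σ z + 1) ≤ σ z' + 1 := by
      intro z hz
      rcases hmem z hz with hz | rfl | hz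
      · exact ⟨z, hms z hz, h1 z (hms z hz) (hsv z hz)⟩
      · exact ⟨u, hms u (by simp), by simp⟩
      · exact ⟨z, hmt z hz, h1 z (hmt z hz) (htv z hz)⟩
    obtain ⟨i', hi', hi1, -⟩ := h2 i hi
    obtain ⟨j', hj', -, hj1⟩ := h2 j hj
    have := h.total i' hi' j' hj'
    linarith

/-- Every nontrivial cap from `u` continues to `v`, so `u` can share the value `Ψ v`, with an edge
of size 1. -/
theorem HasPotential.cons (hρ : ∀ y z, E y z → ρ y < ρ z) (hg : 1 ≤ g 1)
    (hF : (u :: v :: t).Pairwise fun a b => ρ a < ρ b) (hout : ∀ z, E u z → z = v)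
    (h : HasPotential turn ρ g E (v :: t) N) :
    HasPotential turn ρ g E (u :: v :: t) (N + 1) := by
  classical
  obtain ⟨Ψ, σ, h⟩ := h
  have hu : ∀ z ∈ v :: t, ρ u < ρ z := (List.pairwise_cons.1 hF).1
  have hv : ∀ z ∈ v :: t, ρ v ≤ ρ z := (sorted_split (s := []) hF).2.2
  have hne : ∀ z ∈ v :: t, z ≠ u := by
    rintro z hz rfl
    exact absurd (hu z hz) (lt_irrefl _)
  have hv0 := h.pos v (by simp)
  refine ⟨fun z => if z = u then Ψ v else Ψ z, fun z => if z = u then σ v - 1 else σ z,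
    ?_, ?_, ?_, ?_⟩
  · intro z hz
    rcases List.mem_cons.1 hz with rfl | hz
    · simpa using hv0
    · simpa [hne z hz] using h.pos z hz
  · refine List.isChain_cons_cons.2 ⟨?_, ?_⟩
    · refine ⟨1, le_rfl, ?_, ?_, ?_⟩ <;> simp only [hne v (by simp), if_true, if_false]
      · simp
      · exact le_rfl
      · nlinarith
    · refine h.step.imp_of_mem_imp fun a b ha hb hab => ?_
      simpa only [hne a ha, hne b hb, if_false] using hab
  · intro i hi j hj hij
    replace hi := List.mem_cons.1 hi
    replace hj := List.mem_cons.1 hj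
    rcases hi with rfl | hi <;> rcases hj with rfl | hj
    · simp only [if_true]
      rw [div_self hv0.ne']
      exact CapBound.refl hρ
    · simp only [hne j hj, if_true, if_false]
      exact (h.count v (by simp) j hj (hv j hj)).of_unique_out hout (hne j hj)
    · exact absurd hij (not_le.2 (hu i hi))
    · simp only [hne i hi, hne j hj, if_false]
      exact h.count i hi j hj hij
  · intro i hi j hj
    replace hi := List.mem_cons.1 hi
    replace hj := List.mem_cons.1 hj
    rcases hi with rfl | hi <;> rcases hj with rfl | hj
    · have := h.total v (by simp) v (by simp)
      omega
    · have := h.total v (by simp) j hj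
      simp only [hne j hj, if_true, if_false]
      omega
    · have := h.total i hi v (by simp)
      simp only [hne i hi, if_true, if_false]
      omega
    · have := h.total i hi j hj
      simp only [hne i hi, hne j hj, if_false]
      omega

theorem HasPotential.concat (hρ : ∀ y z, E y z → ρ y < ρ z) (hg : 1 ≤ g 1)
    (hF : (s ++ [u, v]).Pairwise fun a b => ρ a < ρ b) (hin : ∀ y, E y v → y = u)
    (h : HasPotential turn ρ g E (s ++ [u]) N) :
    HasPotential turn ρ g E (s ++ [u, v]) (N + 1) := by
  classical
  obtain ⟨Ψ, σ, h⟩ := h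
  obtain ⟨hs, huv, -⟩ := sorted_split hF
  have hne : ∀ z ∈ s ++ [u], z ≠ v := by
    rintro z hz rfl
    exact absurd (hs z hz) (not_le.2 huv)
  have hmem : ∀ z ∈ s ++ [u, v], z ∈ s ++ [u] ∨ z = v := fun z hz => by
    simpa using mem_split_iff.1 hz
  have hu0 := h.pos u (by simp)
  refine ⟨fun z => if z = v then Ψ u else Ψ z, fun z => if z = v then σ u + 1 else σ z,
    ?_, ?_, ?_, ?_⟩
  · intro z hz
    rcases hmem z hz with hz | rfl
    · simpa [hne z hz] using h.pos z hz
    · simpa using hu0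
  · refine List.isChain_append_cons_cons.2 ⟨?_, ?_, by simp⟩
    · refine h.step.imp_of_mem_imp fun a b ha hb hab => ?_
      simpa only [hne a ha, hne b hb, if_false] using hab
    · refine ⟨1, le_rfl, ?_, ?_, ?_⟩ <;> simp only [hne u (by simp), if_true, if_false]
      · simp
      · exact le_rfl
      · nlinarith
  · intro i hi j hj hij
    replace hi := hmem i hi
    replace hj := hmem j hj
    rcases hi with hi | rfl <;> rcases hj with hj | rfl
    · simp only [hne i hi, hne j hj, if_false]
      exact h.count i hi j hj hij
    · simp only [hne i hi, if_true, if_false]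
      exact (h.count i hi u (by simp) (hs i hi)).of_unique_in hin (hne i hi)
    · have := hs j hj
      linarith
    · simp only [if_true]
      rw [div_self hu0.ne']
      exact CapBound.refl hρ
  · intro i hi j hj
    replace hi := hmem i hi
    replace hj := hmem j hj
    rcases hi with hi | rfl <;> rcases hj with hj | rfl
    · have := h.total i hi j hj
      simp only [hne i hi, hne j hj, if_false]
      omega
    · have := h.total i hi u (by simp)
      simp only [hne i hi, if_true, if_false]
      omega
    · have := h.total u (by simp) j hj
      simp only [hne j hj, if_true, if_false]
      omega
    · have := h.total u (by simp) u (by simp)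
      omega

/-- Only `u v` can lead from one side to the other, so crossing counts are products. Rescaling the
right potential to agree with the left one across `u v` turns these products into ratios. The
joining edge has size 1, which the two strict bounds on total size can afford. -/
theorem HasPotential.append (hρ : ∀ y z, E y z → ρ y < ρ z) (hg : 1 ≤ g 1)
    (hF : (s ++ u :: v :: t).Pairwise fun a b => ρ a < ρ b)
    (hE : ∀ y z, E y z → ρ z ≤ ρ u ∨ ρ v ≤ ρ y ∨ (y = u ∧ z = v))
    (h₁ : HasPotential turn ρ g E (s ++ [u]) N₁) (h₂ : HasPotential turn ρ g E (v :: t) N₂) :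
    HasPotential turn ρ g E (s ++ u :: v :: t) (N₁ + N₂) := by
  obtain ⟨Ψ₁, σ₁, h₁⟩ := h₁
  obtain ⟨Ψ₂, σ₂, h₂⟩ := h₂
  obtain ⟨hs, huv, ht⟩ := sorted_split hF
  have ht' : ∀ z ∈ v :: t, ¬ ρ z ≤ ρ u := fun z hz => not_le.2 (huv.trans_le (ht z hz))
  have hu0 := h₁.pos u (by simp)
  have hv0 := h₂.pos v (by simp)
  have hκ : 0 < Ψ₁ u / Ψ₂ v := div_pos hu0 hv0
  refine ⟨fun z => if ρ z ≤ ρ u then Ψ₁ z else Ψ₂ z * (Ψ₁ u / Ψ₂ v),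
    fun z => if ρ z ≤ ρ u then σ₁ z else σ₂ z - σ₂ v + σ₁ u + 1, ?_, ?_, ?_, ?_⟩
  · intro z hz
    rcases mem_split_iff.1 hz with hz | hz
    · simpa [hs z hz] using h₁.pos z hz
    · simp only [ht' z hz, if_false]
      exact mul_pos (h₂.pos z hz) hκ
  · refine List.isChain_append_cons_cons.2 ⟨?_, ?_, ?_⟩
    · refine h₁.step.imp_of_mem_imp fun a b ha hb hab => ?_
      simpa only [hs a ha, hs b hb, if_true] using hab
    · have h1 : Ψ₂ v * (Ψ₁ u / Ψ₂ v) = Ψ₁ u := by field_simp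
      refine ⟨1, le_rfl, ?_, ?_, ?_⟩ <;>
        simp only [ht' v (by simp), le_refl, if_true, if_false, h1]
      · push_cast; ring
      · nlinarith
    · refine h₂.step.imp_of_mem_imp fun a b ha hb hab => ?_
      simp only [ht' a ha, ht' b hb, if_false]
      obtain ⟨n, hn, h1, h2, h3⟩ := hab
      exact ⟨n, hn, by omega, by gcongr, by rw [← mul_assoc]; gcongr⟩
  · intro i hi j hj hij
    replace hi := mem_split_iff.1 hi
    replace hj := mem_split_iff.1 hj
    rcases hi with hi | hi <;> rcases hj with hj | hj
    · simp only [hs i hi, hs j hj, if_true]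
      exact h₁.count i hi j hj hij
    · simp only [hs i hi, ht' j hj, if_true, if_false]
      have hi0 := h₁.pos i hi
      have hsub : ∀ {i j : V} {c : ℝ}, CapBound turn E i j c →
          CapBound turn (fun y z => E y z ∧ ¬ (y = u ∧ z = v)) i j c := fun h =>
        h.of_imp fun l hl => hl.mono_of_rel fun _ _ _ _ _ h => h.1
      -- Without `u v` there are no crossing caps, so only the product term remains.
      have := CapBound.add_edge (E' := fun y z => E y z ∧ ¬ (y = u ∧ z = v)) (u := u) (v := v) hρ
        (fun y z h => by by_cases hyz : y = u ∧ z = v <;> simp [h, hyz])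
        (CapBound.of_forall_not_crossing (hs i hi) (ht j hj) huv fun y z h => by
          rcases hE y z h.1 with h' | h' | h'
          · exact Or.inl h'
          · exact Or.inr h'
          · exact absurd h' h.2)
        (hsub (h₁.count i hi u (by simp) (hs i hi))) (hsub (h₂.count v (by simp) j hj (ht j hj)))
        (div_nonneg hu0.le hi0.le)
      refine this.mono (le_of_eq ?_)
      field_simp
      simp
    · have := hs j hj
      have := ht i hi
      linarith
    · simp only [ht' i hi, ht' j hj, if_false]
      rw [mul_div_mul_right _ _ hκ.ne']
      exact h₂.count i hi j hj hij
  · intro i hi j hj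
    have t1 := h₁.total u (by simp) u (by simp)
    have t2 := h₂.total v (by simp) v (by simp)
    replace hi := mem_split_iff.1 hi
    replace hj := mem_split_iff.1 hj
    rcases hi with hi | hi <;> rcases hj with hj | hj
    · have := h₁.total i hi j hj
      simp only [hs i hi, hs j hj, if_true]
      omega
    · have := h₁.total i hi u (by simp)
      have := h₂.total v (by simp) j hj
      simp only [hs i hi, ht' j hj, if_true, if_false]
      omega
    · have := h₁.total u (by simp) j hj
      have := h₂.total i hi v (by simp)
      simp only [hs j hj, ht' i hi, if_true, if_false]
      omega
    · have := h₂.total i hi j hj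
      simp only [ht' i hi, ht' j hj, if_false]
      omega

end Potential

/-! ### Orientation of triples of points -/

section Orient

variable {a b c d m u v w x y z : Plane} {S : Finset Plane} {G : SimpleGraph Plane}

/-- Twice the signed area of the triangle `a b c`. -/
def orient (a b c : Plane) : ℝ := (b 0 - a 0) * (c 1 - a 1) - (b 1 - a 1) * (c 0 - a 0)

theorem orient_rotate (a b c : Plane) : orient b c a = orient a b c := by
  unfold orient; ring

theorem orient_swap (a b c : Plane) : orient b a c = -orient a b c := by
  unfold orient; ring

theorem orient_swap' (a b c : Plane) : orient a c b = -orient a b c := by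
  unfold orient; ring

@[simp] theorem orient_self_right (a b : Plane) : orient a b b = 0 := by
  unfold orient; ring

@[simp] theorem orient_self_outer (a b : Plane) : orient a b a = 0 := by
  unfold orient; ring

theorem orient_eq_from (m a b c : Plane) :
    orient a b c = orient m a b + orient m b c - orient m a c := by
  unfold orient; ring

/-- The Grassmann–Plücker relation. With `orient_eq_from`, it lets sign patterns of triples seen
from one point decide all the sector and cone arguments below. -/
theorem orient_plucker (m a b c d : Plane) :
    orient m a b * orient m c d - orient m a c * orient m b d + orient m a d * orient m b c = 0 := by
  unfold orient; ring

theorem orient_combo {s t : ℝ} (hst : s + t = 1) (a b x y : Plane) :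
    orient a b (s • x + t • y) = s * orient a b x + t * orient a b y := by
  obtain rfl : s = 1 - t := by linarith
  simp only [orient, PiLp.add_apply, PiLp.smul_apply, smul_eq_mul]
  ring

theorem continuous_orient (a b : Plane) : Continuous fun x => orient a b x := by
  unfold orient
  fun_prop

theorem orient_nonneg_of_mem_segment (hy : 0 ≤ orient a b y) (hz : 0 ≤ orient a b z)
    (hx : x ∈ segment ℝ y z) : 0 ≤ orient a b x := by
  obtain ⟨s, t, hs, ht, hst, rfl⟩ := hx
  rw [orient_combo hst]
  positivity

theorem plane_ext (h0 : a 0 = b 0) (h1 : a 1 = b 1) : a = b := by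
  ext i
  fin_cases i <;> assumption

theorem eq_lineMap_of_orient_eq_zero {t : ℝ} (hab : orient m a b ≠ 0) (h : orient a b x = 0)
    (ht : orient m a x = t * orient m a b) : x = (1 - t) • a + t • b := by
  have h0 : orient m a b * (x 0 - ((1 - t) * a 0 + t * b 0)) = 0 := by
    unfold orient at *
    linear_combination (m 0 - a 0) * h + (b 0 - a 0) * ht
  have h1 : orient m a b * (x 1 - ((1 - t) * a 1 + t * b 1)) = 0 := by
    unfold orient at *
    linear_combination (m 1 - a 1) * h + (b 1 - a 1) * ht
  refine plane_ext ?_ ?_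
  · have := (mul_eq_zero.1 h0).resolve_left hab
    simp only [PiLp.add_apply, PiLp.smul_apply, smul_eq_mul]
    linarith
  · have := (mul_eq_zero.1 h1).resolve_left hab
    simp only [PiLp.add_apply, PiLp.smul_apply, smul_eq_mul]
    linarith

theorem collinear_of_orient_eq_zero (h : orient a b c = 0) :
    Collinear ℝ ({a, b, c} : Set Plane) := by
  by_cases hab : a = b
  · subst hab
    simpa using collinear_pair ℝ a c
  rw [collinear_iff_of_mem (p₀ := a) (by simp)]
  refine ⟨b - a, ?_⟩
  have hne : (b 0 - a 0) ^ 2 + (b 1 - a 1) ^ 2 ≠ 0 := by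
    intro h0
    refine hab (plane_ext ?_ ?_) <;> nlinarith [sq_nonneg (b 0 - a 0), sq_nonneg (b 1 - a 1)]
  intro p hp
  simp only [Set.mem_insert_iff, Set.mem_singleton_iff] at hp
  rcases hp with rfl | rfl | rfl
  · exact ⟨0, by simp⟩
  · exact ⟨1, by simp⟩
  · refine ⟨((p 0 - a 0) * (b 0 - a 0) + (p 1 - a 1) * (b 1 - a 1)) /
      ((b 0 - a 0) ^ 2 + (b 1 - a 1) ^ 2), plane_ext ?_ ?_⟩
    · simp only [vadd_eq_add, PiLp.add_apply, PiLp.smul_apply, PiLp.sub_apply, smul_eq_mul]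
      field_simp
      unfold orient at h
      linear_combination (a 1 - b 1) * h
    · simp only [vadd_eq_add, PiLp.add_apply, PiLp.smul_apply, PiLp.sub_apply, smul_eq_mul]
      field_simp
      unfold orient at h
      linear_combination (b 0 - a 0) * h

theorem NoThreeCollinear.orient_ne_zero (hS : NoThreeCollinear S) (ha : a ∈ S) (hb : b ∈ S)
    (hc : c ∈ S) (hab : a ≠ b) (hac : a ≠ c) (hbc : b ≠ c) : orient a b c ≠ 0 := fun h =>
  hS a ha b hb c hc hab hac hbc (collinear_of_orient_eq_zero h)

theorem orient_nonneg_of_mem_convexHull {A : Set Plane} (hA : ∀ y ∈ A, 0 ≤ orient a b y)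
    (hx : x ∈ convexHull ℝ A) : 0 ≤ orient a b x := by
  have hconv : Convex ℝ {y | 0 ≤ orient a b y} := by
    intro y hy z hz s t hs ht hst
    have hy' : 0 ≤ orient a b y := hy
    have hz' : 0 ≤ orient a b z := hz
    change 0 ≤ orient a b (s • y + t • z)
    rw [orient_combo hst]
    positivity
  exact convexHull_min hA hconv hx

/-- The three areas divided by the area of the triangle are barycentric coordinates. The case `x =
a` is separate, because there the projection of `x` from `a` to `b c` is undefined. -/
theorem mem_convexHull_of_orient_nonneg (h : 0 < orient a b c) (h1 : 0 ≤ orient a b x)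
    (h2 : 0 ≤ orient b c x) (h3 : 0 ≤ orient c a x) :
    x ∈ convexHull ℝ ({a, b, c} : Set Plane) := by
  rw [convexHull_insert (by simp), convexHull_pair, mem_convexJoin]
  simp only [Set.mem_singleton_iff, exists_eq_left]
  have hsum : orient a b x + orient b c x + orient c a x = orient a b c := by
    unfold orient; ring
  have key : ∀ i : Fin 2, orient a b c * x i =
      orient b c x * a i + orient c a x * b i + orient a b x * c i := by
    intro i
    fin_cases i <;> simp only [orient, Fin.zero_eta, Fin.mk_one] <;> ring
  rcases eq_or_lt_of_le (add_nonneg h1 h3) with h0 | h0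
  · refine ⟨b, left_mem_segment ℝ b c, ?_⟩
    have e1 : orient a b x = 0 := by linarith
    have e3 : orient c a x = 0 := by linarith
    have : x = a := by
      have hne : orient b c x ≠ 0 := by linarith
      refine plane_ext ?_ ?_
      · have := key 0
        rw [← hsum, e1, e3] at this
        refine mul_left_cancel₀ hne ?_
        linarith
      · have := key 1
        rw [← hsum, e1, e3] at this
        refine mul_left_cancel₀ hne ?_
        linarith
    rw [this]
    exact left_mem_segment ℝ a b
  · set r := orient a b x + orient c a x with hr
    refine ⟨(orient c a x / r) • b + (orient a b x / r) • c,
      ⟨_, _, by positivity, by positivity, by field_simp; rw [hr]; ring, rfl⟩,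
      ⟨orient b c x / orient a b c, r / orient a b c, by positivity, by positivity,
        by field_simp; linarith, ?_⟩⟩
    refine plane_ext ?_ ?_ <;>
      simp only [PiLp.add_apply, PiLp.smul_apply, smul_eq_mul] <;> field_simp
    · have := key 0
      linarith
    · have := key 1
      linarith

theorem mem_interior_convexHull_of_orient_pos (h1 : 0 < orient a b x)
    (h2 : 0 < orient b c x) (h3 : 0 < orient c a x) :
    x ∈ interior (convexHull ℝ ({a, b, c} : Set Plane)) := by
  have hsum : orient a b x + orient b c x + orient c a x = orient a b c := by
    unfold orient; ring
  have hopen : IsOpen {y | 0 < orient a b y ∧ 0 < orient b c y ∧ 0 < orient c a y} :=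
    (isOpen_lt continuous_const (continuous_orient a b)).inter
      ((isOpen_lt continuous_const (continuous_orient b c)).inter
        (isOpen_lt continuous_const (continuous_orient c a)))
  refine interior_maximal ?_ hopen ⟨h1, h2, h3⟩
  rintro y ⟨hy1, hy2, hy3⟩
  exact mem_convexHull_of_orient_nonneg (by linarith) hy1.le hy2.le hy3.le

theorem orient_nonneg_of_mem_triangle (h : 0 < orient a b c)
    (hx : x ∈ convexHull ℝ ({a, b, c} : Set Plane)) :
    0 ≤ orient a b x ∧ 0 ≤ orient b c x ∧ 0 ≤ orient c a x := by
  refine ⟨?_, ?_, ?_⟩ <;> refine orient_nonneg_of_mem_convexHull ?_ hx <;>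
    simp only [Set.mem_insert_iff, Set.mem_singleton_iff, forall_eq_or_imp, forall_eq,
      orient_self_outer, orient_self_right, le_refl, true_and, and_true]
  · exact h.le
  · exact (orient_rotate a b c).symm ▸ h.le
  · rw [orient_rotate b c a, orient_rotate a b c]
    exact h.le

theorem mem_segment_of_mem_triangle (h : 0 < orient a b c) (h1 : orient a b x = 0)
    (h2 : 0 ≤ orient b c x) (h3 : 0 ≤ orient c a x) : x ∈ segment ℝ a b := by
  have hsum : orient a b x + orient b c x + orient c a x = orient a b c := by
    unfold orient; ring
  have e : x = (1 - orient c a x / orient a b c) • a + (orient c a x / orient a b c) • b := by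
    refine eq_lineMap_of_orient_eq_zero (m := c) ?_ h1 ?_
    · rw [← orient_rotate c a b]; exact h.ne'
    · rw [← orient_rotate c a b]; field_simp
  refine ⟨1 - orient c a x / orient a b c, orient c a x / orient a b c, ?_, by positivity, by ring,
    e.symm⟩
  rw [sub_nonneg, div_le_one h]
  linarith

end Orient

/-! ### Triangles along the edges of a triangulation -/

section Apex

open Filter Topology

variable {a b c d m u v w x y z : Plane} {S : Finset Plane} {G : SimpleGraph Plane}

/-- `u w v` is a face of the drawing on the right side of the edge `u v`. -/
structure IsApex (S : Finset Plane) (G : SimpleGraph Plane) (u v w : Plane) : Prop where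
  adj_left : G.Adj u w
  adj_right : G.Adj v w
  neg : orient u v w < 0
  empty : ∀ x, 0 < orient u w x → 0 < orient w v x → 0 < orient v u x → x ∉ drawing S G

theorem IsPlaneStraightLineGraph.eq_or_eq_of_mem (hG : IsPlaneStraightLineGraph S G)
    (hyz : G.Adj y z) (hv : v ∈ S) (hx : v ∈ segment ℝ y z) : v = y ∨ v = z := by
  rw [← insert_endpoints_openSegment] at hx
  rcases hx with rfl | rfl | hx
  · exact Or.inl rfl
  · exact Or.inr rfl
  · exact absurd hx (hG.vertex_notMem y z hyz v hv)

theorem IsPlaneStraightLineGraph.edge_eq_of_mem (hG : IsPlaneStraightLineGraph S G)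
    (huv : G.Adj u v) (hyz : G.Adj y z) (hx : x ∈ openSegment ℝ u v) (hx' : x ∈ segment ℝ y z) :
    s(u, v) = s(y, z) := by
  by_contra hne
  rw [← insert_endpoints_openSegment] at hx'
  rcases hx' with rfl | rfl | hx'
  · exact hG.vertex_notMem u v huv x (hG.mem_of_adj x z hyz).1 hx
  · exact hG.vertex_notMem u v huv x (hG.mem_of_adj y x hyz).2 hx
  · exact Set.disjoint_left.1 (hG.noncrossing u v y z huv hyz hne) hx hx'

theorem mem_drawing_of_mem_segment (huv : G.Adj u v) (hx : x ∈ segment ℝ u v) :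
    x ∈ drawing S G := Or.inr ⟨u, v, huv, hx⟩

/-- A counterclockwise triangle of the graph whose interior misses the drawing. -/
structure IsFace (S : Finset Plane) (G : SimpleGraph Plane) (a b c : Plane) : Prop where
  adj₁ : G.Adj a b
  adj₂ : G.Adj b c
  adj₃ : G.Adj c a
  pos : 0 < orient a b c
  empty : ∀ x, 0 < orient a b x → 0 < orient b c x → 0 < orient c a x → x ∉ drawing S G

theorem IsFace.rotate (h : IsFace S G a b c) : IsFace S G b c a :=
  ⟨h.adj₂, h.adj₃, h.adj₁, (orient_rotate a b c).symm ▸ h.pos,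
    fun x h1 h2 h3 => h.empty x h3 h1 h2⟩

theorem IsTriangulation.exists_face (hT : IsTriangulation S G) (hS : NoThreeCollinear S)
    (hx : x ∈ convexHull ℝ (S : Set Plane)) :
    ∃ a ∈ S, ∃ b ∈ S, ∃ c ∈ S, IsFace S G a b c ∧ x ∈ convexHull ℝ ({a, b, c} : Set Plane) := by
  rw [← hT.tile] at hx
  simp only [Set.mem_iUnion, Set.mem_ofPred_eq, exists_prop] at hx
  obtain ⟨f, hf, hxf⟩ := hx
  obtain ⟨a, b, c, hab, hbc, hca, hfe⟩ := hT.face_triangle f hf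
  have hempty : ∀ y ∈ f, y ∉ drawing S G := by
    obtain ⟨⟨x₀, -, rfl⟩, -⟩ := hf
    exact fun y hy => connectedComponentIn_subset _ _ hy
  have hxK : x ∈ convexHull ℝ ({a, b, c} : Set Plane) := by
    have hfin : ({a, b, c} : Set Plane).Finite := by simp
    have := closure_mono (interior_subset (s := convexHull ℝ ({a, b, c} : Set Plane)))
    rw [(hfin.isClosed_convexHull (𝕜 := ℝ)).closure_eq, ← hfe] at this
    exact this hxf
  have ha := (hT.mem_of_adj a b hab).1
  have hb := (hT.mem_of_adj a b hab).2
  have hc := (hT.mem_of_adj b c hbc).2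
  rcases lt_or_gt_of_ne (hS.orient_ne_zero ha hb hc hab.ne hca.ne' hbc.ne) with h | h
  · refine ⟨b, hb, a, ha, c, hc, ⟨hab.symm, hca.symm, hbc.symm, ?_, ?_⟩, ?_⟩
    · rw [orient_swap]; linarith
    · intro y h1 h2 h3
      refine hempty y ?_
      rw [hfe, Set.insert_comm]
      exact mem_interior_convexHull_of_orient_pos h1 h2 h3
    · rwa [Set.insert_comm]
  · refine ⟨a, ha, b, hb, c, hc, ⟨hab, hbc, hca, h, ?_⟩, hxK⟩
    intro y h1 h2 h3
    refine hempty y ?_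
    rw [hfe]
    exact mem_interior_convexHull_of_orient_pos h1 h2 h3

/-- A side of the face that contains an inner point of `u v` must be the edge `u v`. The point `y`
of the face to the right of `u v` forces the reversed orientation `a = v`, `b = u`. -/
theorem IsFace.isApex_of_zero (hG : IsPlaneStraightLineGraph S G) (h : IsFace S G a b c)
    (huv : G.Adj u v) (hx : x ∈ openSegment ℝ u v) (h1 : orient a b x = 0)
    (h2 : 0 ≤ orient b c x) (h3 : 0 ≤ orient c a x)
    (hy : y ∈ convexHull ℝ ({a, b, c} : Set Plane)) (hy' : orient u v y < 0) :
    IsApex S G u v c := by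
  have he := hG.edge_eq_of_mem huv h.adj₁ hx (mem_segment_of_mem_triangle h.pos h1 h2 h3)
  have hpos := (orient_nonneg_of_mem_triangle h.pos hy).1
  rcases Sym2.eq_iff.1 he with ⟨rfl, rfl⟩ | ⟨rfl, rfl⟩
  · linarith
  · refine ⟨h.adj₂, h.adj₃.symm, ?_, fun x h1 h2 h3 => h.empty x h3 h1 h2⟩
    rw [orient_swap]
    linarith [h.pos]

/-- Approach the midpoint of `u v` from the right. A single closed face contains points arbitrarily
close to the midpoint, hence the midpoint itself. As a point of the drawing it is not inside the
face, so it lies on a side. -/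
theorem IsTriangulation.exists_isApex (hT : IsTriangulation S G) (hS : NoThreeCollinear S)
    (huv : G.Adj u v) (hy : y ∈ S) (hneg : orient u v y < 0) : ∃ w, IsApex S G u v w := by
  have hu := (hT.mem_of_adj u v huv).1
  have hv := (hT.mem_of_adj u v huv).2
  set μ : Plane := (1 / 2 : ℝ) • u + (1 / 2 : ℝ) • v with hμ
  have hμo : μ ∈ openSegment ℝ u v := ⟨1 / 2, 1 / 2, by norm_num, by norm_num, by norm_num, rfl⟩
  have hμS : μ ∈ convexHull ℝ (S : Set Plane) :=
    (convex_convexHull ℝ _).segment_subset (subset_convexHull ℝ _ hu) (subset_convexHull ℝ _ hv)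
      (openSegment_subset_segment _ _ _ hμo)
  have hμ0 : orient u v μ = 0 := by
    rw [hμ, orient_combo (by norm_num)]; simp
  let p : ℝ → Plane := fun t => (1 - t) • μ + t • y
  have hp : Tendsto p (𝓝[>] 0) (𝓝 μ) := by
    have : Continuous p := by fun_prop
    have h := this.tendsto 0
    simp only [p, sub_zero, one_smul, zero_smul, add_zero] at h
    exact h.mono_left nhdsWithin_le_nhds
  have hev : ∀ᶠ t in 𝓝[>] (0 : ℝ), ∃ a ∈ S, ∃ b ∈ S, ∃ c ∈ S, IsFace S G a b c ∧
      orient u v (p t) < 0 ∧ p t ∈ convexHull ℝ ({a, b, c} : Set Plane) := by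
    filter_upwards [Ioc_mem_nhdsGT (zero_lt_one' ℝ)] with t ht
    have hm : p t ∈ convexHull ℝ (S : Set Plane) :=
      (convex_convexHull ℝ _).segment_subset hμS (subset_convexHull ℝ _ hy)
        ⟨1 - t, t, by linarith [ht.2], ht.1.le, by ring, rfl⟩
    obtain ⟨a, ha, b, hb, c, hc, hf, hx⟩ := hT.exists_face hS hm
    refine ⟨a, ha, b, hb, c, hc, hf, ?_, hx⟩
    simp only [p]
    rw [orient_combo (by ring), hμ0]
    nlinarith [ht.1]
  -- Pigeonhole: there are finitely many triples of vertices, so one of them occurs for parameters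
  -- arbitrarily close to 0.
  have hfr := hev.frequently
  rw [frequently_exists_finset] at hfr
  obtain ⟨a, ha, hfr⟩ := hfr
  rw [frequently_exists_finset] at hfr
  obtain ⟨b, hb, hfr⟩ := hfr
  rw [frequently_exists_finset] at hfr
  obtain ⟨c, hc, hfr⟩ := hfr
  obtain ⟨t, hf, hneg', hmem⟩ := hfr.exists
  have hμK : μ ∈ convexHull ℝ ({a, b, c} : Set Plane) := by
    have hfin : ({a, b, c} : Set Plane).Finite := by simp
    exact (hfin.isClosed_convexHull (𝕜 := ℝ)).mem_of_frequently_of_tendsto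
      (hfr.mono fun t ht => ht.2.2) hp
  obtain ⟨h1, h2, h3⟩ := orient_nonneg_of_mem_triangle hf.pos hμK
  have hμd : μ ∈ drawing S G :=
    mem_drawing_of_mem_segment huv (openSegment_subset_segment _ _ _ hμo)
  rcases h1.eq_or_lt with e1 | l1
  · exact ⟨c, hf.isApex_of_zero hT.toIsPlaneStraightLineGraph huv hμo e1.symm h2 h3 hmem hneg'⟩
  rcases h2.eq_or_lt with e2 | l2
  · refine ⟨a, hf.rotate.isApex_of_zero hT.toIsPlaneStraightLineGraph huv hμo e2.symm h3 h1
      (y := p t) ?_ hneg'⟩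
    rwa [show ({b, c, a} : Set Plane) = {a, b, c} by ext; simp; tauto]
  rcases h3.eq_or_lt with e3 | l3
  · refine ⟨b, hf.rotate.rotate.isApex_of_zero hT.toIsPlaneStraightLineGraph huv hμo e3.symm h1 h2
      (y := p t) ?_ hneg'⟩
    rwa [show ({c, a, b} : Set Plane) = {a, b, c} by ext; simp; tauto]
  · exact absurd hμd (hf.empty μ l1 l2 l3)

end Apex

/-! ### Fronts in the angular order around a point -/

section Front

variable {a b c d m t u v w x y z : Plane} {S : Finset Plane} {G : SimpleGraph Plane}

/-- A real coordinate that increases with the angle around `m`, on the left side of `m c`. -/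
noncomputable def rank (m c x : Plane) : ℝ :=
  -((x 0 - m 0) * (c 0 - m 0) + (x 1 - m 1) * (c 1 - m 1)) / orient m c x

/-- `rank` is minus the cotangent of the angle at `m` from the ray `m c`, which is increasing on (0,
π). -/
theorem rank_lt_rank_iff (ha : 0 < orient m c a) (hb : 0 < orient m c b) :
    rank m c a < rank m c b ↔ 0 < orient m a b := by
  have hpos : 0 < (c 0 - m 0) ^ 2 + (c 1 - m 1) ^ 2 := by
    by_contra hn
    have h0 : c 0 - m 0 = 0 := by nlinarith [sq_nonneg (c 0 - m 0), sq_nonneg (c 1 - m 1)]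
    have h1 : c 1 - m 1 = 0 := by nlinarith [sq_nonneg (c 0 - m 0), sq_nonneg (c 1 - m 1)]
    rw [orient, h0, h1] at ha
    simp at ha
  rw [rank, rank, div_lt_div_iff₀ ha hb, ← sub_pos]
  have : -((b 0 - m 0) * (c 0 - m 0) + (b 1 - m 1) * (c 1 - m 1)) * orient m c a -
      -((a 0 - m 0) * (c 0 - m 0) + (a 1 - m 1) * (c 1 - m 1)) * orient m c b =
      ((c 0 - m 0) ^ 2 + (c 1 - m 1) ^ 2) * orient m a b := by
    unfold orient; ring
  rw [this, mul_pos_iff_of_pos_left hpos]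

/-- The points of the triangle `m u v` outside the side `u v`. -/
def Below (m u v x : Plane) : Prop :=
  0 ≤ orient m u x ∧ 0 ≤ orient m x v ∧ 0 < orient u v x

/-- A short enough step along a segment preserves a strict affine inequality that holds at its
start. -/
theorem exists_near_zero {A : ℝ} (B : ℝ) (hA : 0 < A) :
    ∃ r : ℝ, 0 < r ∧ r ≤ 1 ∧ 0 < (1 - r) * A + r * B := by
  have hB := abs_nonneg B
  have hs : 0 < A + |B| := by linarith
  refine ⟨A / (2 * (A + |B|)), by positivity, ?_, ?_⟩
  · rw [div_le_one (by positivity)]; linarith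
  · have h1 : A / (2 * (A + |B|)) * (A + |B|) = A / 2 := by field_simp
    have h2 : 0 < A / (2 * (A + |B|)) := by positivity
    nlinarith [neg_abs_le B]

theorem mem_segment_combo {r : ℝ} (h0 : 0 < r) (h1 : r ≤ 1) :
    (1 - r) • y + r • z ∈ segment ℝ y z :=
  ⟨1 - r, r, by linarith, h0.le, by ring, rfl⟩

/-- An edge leaving `v` inside the angle of the face runs through the interior of the face near `v`.
-/
theorem IsFace.false_of_adj_cone (h : IsFace S G v a b) (hz : G.Adj v z)
    (h1 : 0 < orient v a z) (h2 : 0 < orient v z b) : False := by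
  obtain ⟨r, hr0, hr1, hr⟩ := exists_near_zero (orient a b z) h.pos
  refine h.empty ((1 - r) • v + r • z) ?_ ?_ ?_
    (mem_drawing_of_mem_segment hz (mem_segment_combo hr0 hr1)) <;> rw [orient_combo (by ring)]
  · simpa using mul_pos hr0 h1
  · rwa [orient_rotate v a b]
  · rw [← orient_rotate b v z] at *
    simpa using mul_pos hr0 h2

theorem exists_below_of_cone_right (huv : 0 < orient m u v) (h1 : 0 ≤ orient v m z)
    (h2 : 0 < orient v z u) : ∃ x ∈ segment ℝ v z, Below m u v x := by
  obtain ⟨r, hr0, hr1, hr⟩ := exists_near_zero (orient m u z) huv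
  refine ⟨_, mem_segment_combo hr0 hr1, ?_, ?_, ?_⟩
  · rw [orient_combo (by ring)]; exact hr.le
  · rw [orient_rotate v m, orient_combo (by ring)]
    simpa using mul_nonneg hr0.le h1
  · rw [orient_combo (by ring)]
    rw [← orient_rotate u v z] at *
    simpa using mul_pos hr0 h2

theorem exists_below_of_cone_left (huv : 0 < orient m u v) (h1 : 0 ≤ orient m u z)
    (h2 : 0 < orient u v z) : ∃ x ∈ segment ℝ u z, Below m u v x := by
  obtain ⟨r, hr0, hr1, hr⟩ := exists_near_zero (orient m z v) huv
  refine ⟨_, mem_segment_combo hr0 hr1, ?_, ?_, ?_⟩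
  · rw [orient_combo (by ring)]
    simpa using mul_nonneg hr0.le h1
  · rw [orient_rotate v m, orient_combo (by ring), ← orient_rotate v m z, ← orient_rotate v m u]
    exact hr.le
  · rw [orient_combo (by ring)]
    simpa using mul_pos hr0 h2

theorem IsApex.isFace (h : IsApex S G u v w) (huv : G.Adj u v) : IsFace S G u w v :=
  ⟨h.adj_left, h.adj_right.symm, huv.symm, by rw [orient_swap']; linarith [h.neg], h.empty⟩

theorem mem_openSegment_of_orient (huv : 0 < orient m u v) (h : orient u v x = 0)
    (h1 : 0 < orient m u x) (h2 : 0 < orient m x v) : x ∈ openSegment ℝ u v := by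
  have e := eq_lineMap_of_orient_eq_zero (t := orient m u x / orient m u v) huv.ne' h
    (by field_simp)
  have hlt : orient m u x / orient m u v < 1 := by
    rw [div_lt_one huv]
    have := orient_eq_from m u v x
    have := orient_swap' m x v
    linarith
  exact ⟨_, _, by linarith, div_pos h1 huv, by ring, e.symm⟩

/-- The part of the triangle `m u w` beyond `m u v`, when `w` lies beyond the edge `u v`. -/
theorem Below.split_left (huv : 0 < orient m u v) (huw : 0 < orient m u w)
    (hwv : 0 < orient m w v) (hneg : orient u v w < 0) (hx : Below m u w x) :
    Below m u v x ∨ x ∈ openSegment ℝ u v ∨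
      (0 < orient u w x ∧ 0 < orient w v x ∧ 0 < orient v u x) := by
  obtain ⟨h1, h2, h3⟩ := hx
  have e1 := orient_eq_from m u w x
  have e2 := orient_eq_from m u v w
  have e3 := orient_eq_from m u v x
  have e4 := orient_eq_from m w v x
  have p := orient_plucker m u v w x
  have s1 := orient_swap' m x w
  have s2 := orient_swap' m w v
  have s3 := orient_swap' m x v
  have s4 := orient_swap u v x
  have hxv : orient m v x ≤ 0 := by
    by_contra hc
    push Not at hc
    nlinarith [mul_pos huw hc, mul_nonneg huv.le h2, mul_nonneg h1 hwv.le]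
  rcases lt_trichotomy 0 (orient u v x) with h | h | h
  · exact Or.inl ⟨h1, by linarith, h⟩
  · refine Or.inr (Or.inl (mem_openSegment_of_orient huv h.symm ?_ ?_))
    · rcases h1.eq_or_lt with h0 | h0
      · exfalso
        have : orient m v x = -orient m u v := by linarith
        rw [← h0, this] at p
        have : orient m u v * (orient m w x + orient m u w) = 0 := by linarith
        rcases mul_eq_zero.1 this with h | h <;> linarith
      · exact h0
    · rcases hxv.eq_or_lt with h0 | h0
      · exfalso
        have : orient m u x = orient m u v := by linarith
        rw [h0, this] at p
        have : orient m u v * (orient m w x + orient m v w) = 0 := by linarith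
        rcases mul_eq_zero.1 this with h | h <;> linarith
      · linarith
  · refine Or.inr (Or.inr ⟨h3, ?_, by linarith⟩)
    have key : 0 < orient m u w * orient w v x := by
      have : orient m u w * orient w v x = orient m w v * (orient m u w - orient m u x) +
          orient m w x * (orient m u v - orient m u w) := by
        rw [e4]
        linear_combination -p + orient m u x * s2
      rw [this]
      rcases le_total (orient m u v) (orient m u w) with hle | hle
      · have := mul_nonneg (sub_nonneg.2 hle) h2
        nlinarith [mul_pos hwv (show 0 < orient m u w - orient m u x by linarith)]
      · nlinarith [mul_nonneg (sub_nonneg.2 hle) h2,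
          mul_pos hwv (show 0 < orient m u w - orient m u x + orient m w x by linarith),
          mul_nonneg (show 0 ≤ orient m w v - (orient m u v - orient m u w) by linarith) h2]
    exact (mul_pos_iff_of_pos_left huw).1 key

theorem Below.split_right (huv : 0 < orient m u v) (huw : 0 < orient m u w)
    (hwv : 0 < orient m w v) (hneg : orient u v w < 0) (hx : Below m w v x) :
    Below m u v x ∨ x ∈ openSegment ℝ u v ∨
      (0 < orient u w x ∧ 0 < orient w v x ∧ 0 < orient v u x) := by
  obtain ⟨h1, h2, h3⟩ := hx
  have e1 := orient_eq_from m u w x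
  have e2 := orient_eq_from m u v w
  have e3 := orient_eq_from m u v x
  have e4 := orient_eq_from m w v x
  have p := orient_plucker m u v w x
  have s2 := orient_swap' m w v
  have s3 := orient_swap' m x v
  have s4 := orient_swap u v x
  have hux : 0 ≤ orient m u x := by
    by_contra hc
    push Not at hc
    nlinarith [mul_pos_of_neg_of_neg hc (show orient m v w < 0 by linarith),
      mul_nonneg huv.le h1, mul_nonneg huw.le h2]
  rcases lt_trichotomy 0 (orient u v x) with h | h | h
  · exact Or.inl ⟨hux, h2, h⟩
  · refine Or.inr (Or.inl (mem_openSegment_of_orient huv h.symm ?_ ?_))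
    · rcases hux.eq_or_lt with h0 | h0
      · exfalso
        have : orient m v x = -orient m u v := by linarith
        rw [← h0, this] at p
        have : orient m u v * (orient m w x + orient m u w) = 0 := by linarith
        rcases mul_eq_zero.1 this with h | h <;> linarith
      · exact h0
    · rcases h2.eq_or_lt with h0 | h0
      · exfalso
        have h0' : orient m v x = 0 := by linarith
        have : orient m u x = orient m u v := by linarith
        rw [h0', this] at p
        have : orient m u v * (orient m w x + orient m v w) = 0 := by linarith
        rcases mul_eq_zero.1 this with h | h <;> linarith
      · exact h0
  · refine Or.inr (Or.inr ⟨?_, h3, by linarith⟩)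
    have key : 0 < orient m w v * orient u w x := by
      have : orient m w v * orient u w x = orient m u w * (orient m w v - orient m x v) +
          orient m w x * (orient m w v - orient m u v) := by
        rw [e1]
        linear_combination p - orient m u x * s2 + orient m u w * s3
      rw [this]
      rcases le_total (orient m u v) (orient m w v) with hle | hle
      · have := mul_nonneg (sub_nonneg.2 hle) h1
        nlinarith [mul_pos huw (show 0 < orient m w v - orient m x v by linarith)]
      · nlinarith [mul_nonneg (sub_nonneg.2 hle) h1,
          mul_pos huw (show 0 < orient m w v - orient m x v - orient m w x by linarith),
          mul_nonneg (show 0 ≤ orient m u w - (orient m u v - orient m w v) by linarith) h1]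
    exact (mul_pos_iff_of_pos_left hwv).1 key

/-- The triangle `m u x` is covered by `m u v`, `m v x` and `u x v` when `v` lies inside. -/
theorem Below.cover (huv : 0 < orient m u v) (hvx : 0 < orient m v x)
    (hneg : orient u v x < 0) (ht : Below m u x t) :
    Below m u v t ∨ Below m v x t ∨ t = v ∨ t ∈ openSegment ℝ u v ∨ t ∈ openSegment ℝ v x ∨
      (0 < orient u x t ∧ 0 < orient x v t ∧ 0 < orient v u t) := by
  obtain ⟨h1, h2, h3⟩ := ht
  have e1 := orient_eq_from m u x t
  have e2 := orient_eq_from m u v x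
  have e3 := orient_eq_from m u v t
  have e4 := orient_eq_from m v x t
  have e5 := orient_eq_from m x v t
  have p := orient_plucker m u v x t
  have s1 := orient_swap' m t x
  have s2 := orient_swap' m t v
  have s3 := orient_swap' m x v
  have s4 := orient_swap u v t
  have s5 := orient_swap v x t
  rcases le_total (orient m v t) 0 with hv | hv
  · rcases lt_trichotomy 0 (orient u v t) with h | h | h
    · exact Or.inl ⟨h1, by linarith, h⟩
    · rcases hv.eq_or_lt with h0 | h0
      · refine Or.inr (Or.inr (Or.inl ?_))
        have e := eq_lineMap_of_orient_eq_zero (t := 1) huv.ne' h.symm (by linarith)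
        simpa using e
      · refine Or.inr (Or.inr (Or.inr (Or.inl (mem_openSegment_of_orient huv h.symm ?_ ?_))))
        · rcases h1.eq_or_lt with h00 | h00
          · exfalso
            have h01 : orient m v t = -orient m u v := by linarith
            rw [← h00, h01] at p
            have : orient m u v * (orient m x t + orient m u x) = 0 := by linarith
            rcases mul_eq_zero.1 this with h | h <;> linarith
          · exact h00
        · linarith
    · refine Or.inr (Or.inr (Or.inr (Or.inr (Or.inr ⟨h3, ?_, by linarith⟩))))
      have key : 0 < orient m u v * orient x v t := by
        have : orient m u v * orient x v t = orient m v x * (orient m u t - orient m u v) +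
            (orient m u x - orient m u v) * (-orient m v t) := by
          rw [e5]
          linear_combination -p + orient m u v * s3
        rw [this]
        nlinarith [mul_pos hvx (show 0 < orient m u t - orient m u v - orient m v t by linarith),
          mul_nonneg (show 0 ≤ orient m u x - orient m u v - orient m v x by linarith)
            (show 0 ≤ -orient m v t by linarith)]
      exact (mul_pos_iff_of_pos_left huv).1 key
  · rcases lt_trichotomy 0 (orient v x t) with h | h | h
    · exact Or.inr (Or.inl ⟨hv, h2, h⟩)
    · rcases hv.eq_or_lt with h0 | h0
      · refine Or.inr (Or.inr (Or.inl ?_))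
        have e := eq_lineMap_of_orient_eq_zero (t := 0) hvx.ne' h.symm (by linarith)
        simpa using e
      · refine Or.inr (Or.inr (Or.inr (Or.inr (Or.inl
          (mem_openSegment_of_orient hvx h.symm h0 ?_)))))
        rcases h2.eq_or_lt with h00 | h00
        · exfalso
          have h01 : orient m v t = orient m v x := by linarith
          have h02 : orient m x t = 0 := by linarith
          rw [h01, h02] at p
          have : orient m v x * (orient m u t - orient m u x) = 0 := by linarith
          rcases mul_eq_zero.1 this with h | h <;> linarith
        · exact h00
    · refine Or.inr (Or.inr (Or.inr (Or.inr (Or.inr ⟨h3, by linarith, ?_⟩))))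
      have key : 0 < orient m v x * orient v u t := by
        have : orient m v x * orient v u t = orient m u v * (-orient m x t - orient m v x) +
            (orient m u x - orient m v x) * orient m v t := by
          rw [s4, e3]
          linear_combination p
        rw [this]
        nlinarith [mul_pos huv (show 0 < -orient m x t - orient m v x + orient m v t by linarith),
          mul_nonneg (show 0 ≤ orient m u x - orient m u v - orient m v x by linarith) hv]
      exact (mul_pos_iff_of_pos_left hvx).1 key

end Front

/-! ### Front edges and the moves of the sweep -/

section Sweep

variable {a b c d m t u v w x y z : Plane} {S B : Finset Plane} {G : SimpleGraph Plane}
  {E : Plane → Plane → Prop}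

/-- An edge `u v` of a front: no edge of `E` passes below it, and all points of `S` beyond it lie
in `B`. -/
structure IsLink (S : Finset Plane) (G : SimpleGraph Plane) (m : Plane) (E : Plane → Plane → Prop)
    (B : Finset Plane) (u v : Plane) : Prop where
  adj : G.Adj u v
  pos : 0 < orient m u v
  free : ∀ y z, E y z → ∀ x ∈ segment ℝ y z, ¬ Below m u v x
  fresh : ∀ b ∈ S, 0 < orient m u b → 0 < orient m b v → orient u v b < 0 → b ∈ B

/-- A front `F`, with the directed edges `E` and the vertices `B` on or above it. -/
structure IsFront (S : Finset Plane) (G : SimpleGraph Plane) (m c : Plane)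
    (E : Plane → Plane → Prop) (B : Finset Plane) (F : List Plane) : Prop where
  subset : ∀ b ∈ B, b ∈ S ∧ 0 < orient m c b
  edge : ∀ y z, E y z → G.Adj y z ∧ 0 < orient m c y ∧ 0 < orient m c z ∧ 0 < orient m y z
  mem : ∀ v ∈ F, v ∈ B
  link : F.IsChain (IsLink S G m E B)

theorem IsLink.mono {E' : Plane → Plane → Prop} {B' : Finset Plane} (h : IsLink S G m E B u v)
    (hE : ∀ y z, E' y z → E y z)
    (hB : ∀ b ∈ B, 0 < orient m u b → 0 < orient m b v → b ∈ B') : IsLink S G m E' B' u v :=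
  ⟨h.adj, h.pos, fun y z hyz => h.free y z (hE y z hyz),
    fun b hb h1 h2 h3 => hB b (h.fresh b hb h1 h2 h3) h1 h2⟩

/-- The regions below `u w` and `w v` lie in the union of the region below `u v`, the open edge `u
v` and the empty face `u w v`. Once `u v` is removed, no remaining edge meets any of these. -/
theorem IsLink.insert (hG : IsPlaneStraightLineGraph S G) (h : IsLink S G m E B u v)
    (hE : ∀ y z, E y z → G.Adj y z ∧ 0 < orient m y z) (hw : IsApex S G u v w)
    (huw : 0 < orient m u w) (hwv : 0 < orient m w v) :
    w ∈ B ∧ IsLink S G m (fun y z => E y z ∧ ¬ (y = u ∧ z = v)) B u w ∧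
      IsLink S G m (fun y z => E y z ∧ ¬ (y = u ∧ z = v)) B w v := by
  have key : ∀ y z, (E y z ∧ ¬ (y = u ∧ z = v)) → ∀ x ∈ segment ℝ y z,
      ¬ (Below m u v x ∨ x ∈ openSegment ℝ u v ∨
      (0 < orient u w x ∧ 0 < orient w v x ∧ 0 < orient v u x)) := by
    rintro y z ⟨hyz, hne⟩ x hx (hb | ho | ⟨h1, h2, h3⟩)
    · exact h.free y z hyz x hx hb
    · have he := hG.edge_eq_of_mem h.adj (hE y z hyz).1 ho hx
      rcases Sym2.eq_iff.1 he with ⟨rfl, rfl⟩ | ⟨rfl, rfl⟩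
      · exact hne ⟨rfl, rfl⟩
      · have h1 := (hE _ _ hyz).2
        have h2 := h.pos
        rw [orient_swap'] at h2
        linarith
    · exact hw.empty x h1 h2 h3 (mem_drawing_of_mem_segment (hE y z hyz).1 hx)
  have e := orient_eq_from m u v w
  have s := orient_swap' m w v
  have hneg := hw.neg
  refine ⟨h.fresh w (hG.mem_of_adj u w hw.adj_left).2 huw hwv hneg,
    ⟨hw.adj_left, huw, ?_, ?_⟩, ⟨hw.adj_right.symm, hwv, ?_, ?_⟩⟩
  · exact fun y z hyz x hx hb => key y z hyz x hx (hb.split_left h.pos huw hwv hneg)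
  · intro b hb h1 h2 h3
    have e1 := orient_eq_from m u w b
    have e2 := orient_eq_from m u v b
    have s1 := orient_swap' m b v
    have s2 := orient_swap' m b w
    have p := orient_plucker m u v w b
    have hbv : 0 < orient m b v := by
      by_contra hc
      push Not at hc
      nlinarith [mul_pos h.pos h2, mul_pos h1 hwv, mul_nonneg huw.le (neg_nonneg.2 hc)]
    refine h.fresh b hb h1 hbv ?_
    by_contra hc
    push Not at hc
    have h4 : 0 < orient m b w := h2
    nlinarith [mul_pos hwv h1, mul_pos h.pos h2, mul_pos huw hbv,
      mul_nonneg huw.le hc, mul_pos (neg_pos.2 h3) h.pos, mul_pos (neg_pos.2 hneg) h1]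
  · exact fun y z hyz x hx hb => key y z hyz x hx (hb.split_right h.pos huw hwv hneg)
  · intro b hb h1 h2 h3
    have e1 := orient_eq_from m w v b
    have e2 := orient_eq_from m u v b
    have s1 := orient_swap' m b v
    have p := orient_plucker m u v w b
    have hub : 0 < orient m u b := by
      by_contra hc
      push Not at hc
      nlinarith [mul_pos h.pos h1, mul_pos huw h2, mul_nonneg hwv.le (neg_nonneg.2 hc)]
    refine h.fresh b hb hub h2 ?_
    by_contra hc
    push Not at hc
    nlinarith [mul_pos hwv hub, mul_pos h.pos h1, mul_pos huw h2,
      mul_nonneg hwv.le hc, mul_pos (neg_pos.2 h3) h.pos, mul_pos (neg_pos.2 hneg) h2]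

/-- At a vertex, an edge between two rays that span a half plane with the ray towards `m`. -/
theorem orient_pos_of_cone (h1 : 0 < orient v m a) (h2 : orient v m b < 0) (h3 : orient v m z < 0)
    (h4 : 0 < orient v a b) (h5 : 0 < orient v z b) : 0 < orient v a z := by
  have p := orient_plucker v m a z b
  by_contra hc
  push Not at hc
  nlinarith [mul_pos h1 h5, mul_pos (neg_pos.2 h3) h4, mul_nonneg (neg_nonneg.2 h2.le)
    (neg_nonneg.2 hc)]

/-- Since `w` comes before `u` in angle, the cone of the face at `u` covers all forward directions
beyond `u v`. The forward directions on the other side of `u v` enter the region below the link. -/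
theorem IsLink.eq_of_adj_left (hG : IsPlaneStraightLineGraph S G) (hS : NoThreeCollinear S)
    (h : IsLink S G m E B u v) (hw : IsApex S G u v w) (hwu : 0 < orient m w u) (huz : E u z)
    (hz : G.Adj u z) (hmz : 0 < orient m u z) : z = v := by
  by_contra hne
  have h0 : orient u v z ≠ 0 := hS.orient_ne_zero (hG.mem_of_adj u v h.adj).1
    (hG.mem_of_adj u v h.adj).2 (hG.mem_of_adj u z hz).2 h.adj.ne hz.ne (Ne.symm hne)
  rcases lt_or_gt_of_ne h0 with h1 | h1
  · have hf := hw.isFace h.adj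
    have hzv : 0 < orient u z v := by rw [orient_swap']; linarith
    refine hf.false_of_adj_cone hz (orient_pos_of_cone (m := m) ?_ ?_ ?_ ?_ hzv) hzv
    · rwa [← orient_rotate u m w]
    · rw [orient_swap]; linarith [h.pos]
    · rw [orient_swap]; linarith
    · exact hf.pos
  · obtain ⟨x, hx, hb⟩ := exists_below_of_cone_left h.pos hmz.le h1
    exact h.free u z huz x hx hb

theorem IsLink.eq_of_adj_right (hG : IsPlaneStraightLineGraph S G) (hS : NoThreeCollinear S)
    (h : IsLink S G m E B u v) (hw : IsApex S G u v w) (hvw : 0 < orient m v w) (hzv : E z v)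
    (hz : G.Adj v z) (hmz : 0 < orient m z v) : z = u := by
  by_contra hne
  have h0 : orient v z u ≠ 0 := hS.orient_ne_zero (hG.mem_of_adj u v h.adj).2
    (hG.mem_of_adj v z hz).2 (hG.mem_of_adj u v h.adj).1 hz.ne h.adj.ne' hne
  have hmz' : 0 < orient v m z := by rwa [← orient_rotate v m z]
  rcases lt_or_gt_of_ne h0 with h1 | h1
  · have hf := (hw.isFace h.adj).rotate.rotate
    have huz : 0 < orient v u z := by rw [orient_swap']; linarith
    refine hf.false_of_adj_cone hz huz ?_
    have p := orient_plucker v m u z w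
    have p1 : 0 < orient v m u := by rw [← orient_rotate v m u]; exact h.pos
    have p2 : orient v m w < 0 := by rw [orient_swap]; linarith
    have p3 := hf.pos
    by_contra hc
    push Not at hc
    nlinarith [mul_pos hmz' p3, mul_pos (neg_pos.2 p2) huz, mul_nonneg p1.le (neg_nonneg.2 hc)]
  · obtain ⟨x, hx, hb⟩ := exists_below_of_cone_right h.pos hmz'.le h1
    exact h.free z v hzv x (segment_symm ℝ v z ▸ hx) hb

/-- Otherwise, depending on the order of `v w` and `v x` around `v`, one of these edges enters the
face on the other link. -/
theorem IsLink.apex_eq (hG : IsPlaneStraightLineGraph S G) (hS : NoThreeCollinear S)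
    (h₁ : IsLink S G m E B u v) (h₂ : IsLink S G m E B v x) (hw : IsApex S G u v w)
    (hvw : 0 < orient m v w) (hy : IsApex S G v x y) (hyv : 0 < orient m y v) : w = x := by
  by_contra hne
  have h0 : orient v x w ≠ 0 := hS.orient_ne_zero (hG.mem_of_adj u v h₁.adj).2
    (hG.mem_of_adj v x h₂.adj).2 (hG.mem_of_adj v w hw.adj_right).2 h₂.adj.ne
    hw.adj_right.ne (Ne.symm hne)
  have hmw : orient v m w < 0 := by rw [orient_swap]; linarith
  have hmx : orient v m x < 0 := by rw [orient_swap]; linarith [h₂.pos]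
  rcases lt_or_gt_of_ne h0 with h | h
  · have hf := hy.isFace h₂.adj
    have hwx : 0 < orient v w x := by rw [orient_swap']; linarith
    refine hf.false_of_adj_cone hw.adj_right (orient_pos_of_cone ?_ hmx hmw hf.pos hwx) hwx
    rwa [← orient_rotate v m y]
  · have hf := (hw.isFace h₁.adj).rotate.rotate
    refine hf.false_of_adj_cone h₂.adj (orient_pos_of_cone ?_ hmw hmx hf.pos h) h
    rw [← orient_rotate v m u]
    exact h₁.pos

/-- The rays from `v` to `m`, `u` and `x` divide the full turn into three cones: one below each link
and the cone of the face `u x v`. No edge can leave `v` inside any of them. -/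
theorem IsLink.eq_or_eq_of_adj (hG : IsPlaneStraightLineGraph S G) (hS : NoThreeCollinear S)
    (h₁ : IsLink S G m E B u v) (h₂ : IsLink S G m E B v x) (hw : IsApex S G u v x)
    (hz : G.Adj v z) (hfree₁ : ∀ t ∈ segment ℝ v z, ¬ Below m u v t)
    (hfree₂ : ∀ t ∈ segment ℝ v z, ¬ Below m v x t) : z = u ∨ z = x := by
  by_contra hne
  push Not at hne
  have hu := (hG.mem_of_adj u v h₁.adj).1
  have hv := (hG.mem_of_adj u v h₁.adj).2
  have hx := (hG.mem_of_adj v x h₂.adj).2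
  have hzS := (hG.mem_of_adj v z hz).2
  have h0 : orient v u z ≠ 0 := hS.orient_ne_zero hv hu hzS h₁.adj.ne' hz.ne (Ne.symm hne.1)
  have h0' : orient v x z ≠ 0 := hS.orient_ne_zero hv hx hzS h₂.adj.ne hz.ne (Ne.symm hne.2)
  have hf := (hw.isFace h₁.adj).rotate.rotate
  have hux : 0 < orient v u x := hf.pos
  have hmu : 0 < orient v m u := by rw [← orient_rotate v m u]; exact h₁.pos
  have hmx : orient v m x < 0 := by rw [orient_swap]; linarith [h₂.pos]
  have p := orient_plucker v m u x z
  have s1 := orient_swap' v u z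
  have s2 := orient_swap' v x z
  have hvm : orient m v z = -orient v m z := orient_swap v m z
  have c1 : ¬ (0 ≤ orient v m z ∧ 0 < orient v z u) := fun ⟨h1, h2⟩ => by
    obtain ⟨t, ht, hb⟩ := exists_below_of_cone_right h₁.pos h1 h2
    exact hfree₁ t ht hb
  have c2 : ¬ (0 ≤ orient m v z ∧ 0 < orient v x z) := fun ⟨h1, h2⟩ => by
    obtain ⟨t, ht, hb⟩ := exists_below_of_cone_left h₂.pos h1 h2
    exact hfree₂ t ht hb
  have c3 : ¬ (0 < orient v u z ∧ 0 < orient v z x) := fun ⟨h1, h2⟩ =>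
    hf.false_of_adj_cone hz h1 h2
  rcases lt_or_gt_of_ne h0 with h1 | h1
  · have hm : orient v m z < 0 := by
      by_contra hc
      push Not at hc
      exact c1 ⟨hc, by linarith⟩
    refine c2 ⟨by linarith, ?_⟩
    by_contra hc
    push Not at hc
    nlinarith [mul_pos_of_neg_of_neg hmx h1, mul_pos (neg_pos.2 hm) hux,
      mul_nonneg hmu.le (neg_nonneg.2 hc)]
  · have hxz : 0 < orient v x z := by
      by_contra hc
      push Not at hc
      have : orient v x z < 0 := lt_of_le_of_ne hc h0'
      exact c3 ⟨h1, by linarith⟩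
    have hm : 0 < orient v m z := by
      by_contra hc
      push Not at hc
      exact c2 ⟨by linarith, hxz⟩
    nlinarith [mul_pos hmu hxz, mul_pos (neg_pos.2 hmx) h1, mul_pos hm hux]

/-- Here `v` lies inside the triangle `m u x`. By `Below.cover`, whatever is below `u x` is below an
old link, on one, or in the empty face, and edges avoiding `v` meet none of these. -/
theorem IsLink.bypass (hG : IsPlaneStraightLineGraph S G)
    (h₁ : IsLink S G m E B u v) (h₂ : IsLink S G m E B v x) (hux : 0 < orient m u x)
    (hgen : ∀ b ∈ S, b ≠ v → orient m v b ≠ 0)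
    (hE : ∀ y z, E y z → G.Adj y z) (hw : IsApex S G u v x) :
    IsLink S G m (fun y z => E y z ∧ y ≠ v ∧ z ≠ v) (B.erase v) u x := by
  refine ⟨hw.adj_left, hux, ?_, ?_⟩
  · rintro y z ⟨hyz, hyv, hzv⟩ t ht hb
    have hadj := hE y z hyz
    have hno : ∀ p, s(p, v) ≠ s(y, z) := by
      intro p hp
      rcases Sym2.eq_iff.1 hp with ⟨-, h⟩ | ⟨-, h⟩
      · exact hzv h.symm
      · exact hyv h.symm
    rcases hb.cover h₁.pos h₂.pos hw.neg with h | h | rfl | h | h | ⟨h1, h2, h3⟩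
    · exact h₁.free y z hyz t ht h
    · exact h₂.free y z hyz t ht h
    · rcases hG.eq_or_eq_of_mem hadj (hG.mem_of_adj u t h₁.adj).2 ht with h | h
      · exact hyv h.symm
      · exact hzv h.symm
    · exact hno u (hG.edge_eq_of_mem h₁.adj hadj h ht)
    · have := hG.edge_eq_of_mem h₂.adj hadj h ht
      rw [Sym2.eq_swap] at this
      exact hno x this
    · exact hw.empty t h1 h2 h3 (mem_drawing_of_mem_segment hadj ht)
  · intro b hb h1 h2 h3
    have hvS := (hG.mem_of_adj u v h₁.adj).2
    have e1 := orient_eq_from m u x b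
    have e2 := orient_eq_from m u v x
    have e3 := orient_eq_from m u v b
    have e4 := orient_eq_from m v x b
    have s1 := orient_swap' m b x
    have s2 := orient_swap' m b v
    have p := orient_plucker m u v x b
    have hneg := hw.neg
    have hp1 := h₁.pos
    have hp2 := h₂.pos
    have hbv : b ≠ v := by
      rintro rfl
      have := orient_swap' u x b
      linarith
    refine Finset.mem_erase.2 ⟨hbv, ?_⟩
    -- General position puts `b` strictly in the angle of `u v` or of `v x`. A point beyond `u x` is
    -- then beyond that link.
    rcases lt_or_gt_of_ne (hgen b hb hbv) with h | h
    · refine h₁.fresh b hb h1 (by linarith) ?_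
      by_contra hc
      push Not at hc
      nlinarith [mul_pos hp2 (neg_pos.2 h3), mul_nonneg hux.le hc, mul_pos hp1 h2,
        mul_pos hp2 h1, mul_pos hux (neg_pos.2 h), mul_pos (neg_pos.2 hneg) (neg_pos.2 h),
        mul_pos (neg_pos.2 hneg) h1, mul_nonneg hp2.le hc]
    · refine h₂.fresh b hb h h2 ?_
      by_contra hc
      push Not at hc
      nlinarith [mul_pos hp1 (neg_pos.2 h3), mul_nonneg hux.le hc, mul_pos hp1 h2,
        mul_pos hp2 h1, mul_pos hux h, mul_pos (neg_pos.2 hneg) h,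
        mul_pos (neg_pos.2 hneg) h2, mul_nonneg hp1.le hc]

/-- All of `S` lies on the near side of a hull edge, so any other edge that meets the angle of `u v`
would pass below it. -/
theorem IsLink.hull (hG : IsPlaneStraightLineGraph S G) (hS : NoThreeCollinear S)
    (h : IsLink S G m E B u v) (hu : 0 < orient m c u) (hhull : ∀ b ∈ S, 0 ≤ orient u v b)
    (hyz : E y z) (hadj : G.Adj y z) (hy : 0 < orient m c y) (hz : 0 < orient m c z) :
    orient m u z ≤ 0 ∨ orient m y v ≤ 0 ∨ (y = u ∧ z = v) := by
  by_contra hcon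
  push Not at hcon
  obtain ⟨huz, hyv, hne⟩ := hcon
  have huS := (hG.mem_of_adj u v h.adj).1
  have hvS := (hG.mem_of_adj u v h.adj).2
  have hyS := (hG.mem_of_adj y z hadj).1
  have hzS := (hG.mem_of_adj y z hadj).2
  have hpos' : ∀ b ∈ S, b ≠ u → b ≠ v → 0 < orient u v b := fun b hb h1 h2 =>
    lt_of_le_of_ne (hhull b hb)
      (hS.orient_ne_zero huS hvS hb h.adj.ne (Ne.symm h1) (Ne.symm h2)).symm
  have hyv' : y ≠ v := by rintro rfl; simp at hyv
  have hzu' : z ≠ u := by rintro rfl; simp at huz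
  by_cases hyu : y = u
  · subst hyu
    have hzv : z ≠ v := fun h => hne rfl h
    obtain ⟨x, hx, hb⟩ := exists_below_of_cone_left h.pos huz.le (hpos' z hzS hzu' hzv)
    exact h.free y z hyz x hx hb
  have hy' := hpos' y hyS hyu hyv'
  rcases le_or_gt 0 (orient m u y) with h1 | h1
  · exact h.free y z hyz y (left_mem_segment ℝ y z) ⟨h1, hyv.le, hy'⟩
  · set s := orient m u z - orient m u y with hs
    have hs0 : 0 < s := by linarith
    -- The weights give the point where `y z` crosses the ray from `m` through `u`.
    refine h.free y z hyz ((orient m u z / s) • y + (-orient m u y / s) • z)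
      ⟨_, _, by positivity, div_nonneg (by linarith) hs0.le,
        by rw [← add_div]; field_simp; rw [hs]; ring, rfl⟩ ?_
    have hsum : orient m u z / s + -orient m u y / s = 1 := by
      rw [← add_div, ← sub_eq_add_neg, ← hs, div_self hs0.ne']
    have hc1 : 0 < orient m u z / s := div_pos huz hs0
    have hc2 : 0 < -orient m u y / s := div_pos (by linarith) hs0
    set p := (orient m u z / s) • y + (-orient m u y / s) • z with hp
    have hup : orient m u p = 0 := by
      rw [hp, orient_combo hsum]; field_simp; ring
    have hcp : 0 < orient m c p := by
      rw [hp, orient_combo hsum]; positivity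
    refine ⟨hup.ge, ?_, ?_⟩
    · have pl := orient_plucker m c u p v
      have e : orient m c u * orient m p v = orient m c p * orient m u v := by
        rw [hup] at pl; linarith
      have h2 := mul_pos hcp h.pos
      rw [← e] at h2
      exact ((mul_pos_iff_of_pos_left hu).1 h2).le
    · rw [hp, orient_combo hsum]
      have := hhull z hzS
      positivity

end Sweep

/-! ### The sweep induction -/

section Induction

variable {m c : Plane} {S B : Finset Plane} {G : SimpleGraph Plane}
  {E : Plane → Plane → Prop} {F : List Plane} {g : ℕ → ℝ}

/-- If the first pair is not `P` and the last is not `Q`, the labels must switch from `Q` to `P`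
somewhere. Below, `P` says that the apex comes before the edge in angle, and `Q` that it comes
after. -/
theorem exists_first_or_last_or_switch {V : Type*} {P Q : V → V → Prop} :
    ∀ (l : List V) (a b : V), (a :: b :: l).IsChain (fun u v => P u v ∨ Q u v) →
      P a b ∨ (∃ s u v, a :: b :: l = s ++ [u, v] ∧ Q u v) ∨
        ∃ s u v x t, a :: b :: l = s ++ u :: v :: x :: t ∧ Q u v ∧ P v x := by
  intro l
  induction l with
  | nil =>
    intro a b h
    rcases (List.isChain_cons_cons.1 h).1 with h | h
    · exact Or.inl h
    · exact Or.inr (Or.inl ⟨[], a, b, rfl, h⟩)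
  | cons y l ih =>
    intro a b h
    rw [List.isChain_cons_cons] at h
    rcases h.1 with hP | hQ
    · exact Or.inl hP
    rcases ih b y h.2 with hP | ⟨s, u, v, he, hq⟩ | ⟨s, u, v, x, t, he, hq, hp⟩
    · exact Or.inr (Or.inr ⟨[], a, b, y, l, rfl, hQ, hP⟩)
    · exact Or.inr (Or.inl ⟨a :: s, u, v, by rw [he]; rfl, hq⟩)
    · exact Or.inr (Or.inr ⟨a :: s, u, v, x, t, by rw [he]; rfl, hq, hp⟩)

theorem IsFront.pos_of_mem (h : IsFront S G m c E B F) {v : Plane} (hv : v ∈ F) :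
    0 < orient m c v := (h.subset v (h.mem v hv)).2

theorem IsFront.rank_lt (h : IsFront S G m c E B F) (y z : Plane) (hyz : E y z) :
    rank m c y < rank m c z := by
  obtain ⟨-, h1, h2, h3⟩ := h.edge y z hyz
  exact (rank_lt_rank_iff h1 h2).2 h3

theorem IsFront.pairwise (h : IsFront S G m c E B F) :
    F.Pairwise fun a b => rank m c a < rank m c b := by
  have hc : F.IsChain fun a b => rank m c a < rank m c b :=
    h.link.imp_of_mem_imp fun a b ha hb hab =>
      (rank_lt_rank_iff (h.pos_of_mem ha) (h.pos_of_mem hb)).2 hab.pos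
  have : Trans (fun a b : Plane => rank m c a < rank m c b)
    (fun a b : Plane => rank m c a < rank m c b)
    (fun a b : Plane => rank m c a < rank m c b) := ⟨fun h1 h2 => lt_trans h1 h2⟩
  exact hc.pairwise

theorem IsFront.nodup (h : IsFront S G m c E B F) : F.Nodup :=
  h.pairwise.imp fun hab => by rintro rfl; exact lt_irrefl _ hab

/-- Induction on a bound `k` for 2|B| − |F|. Advancing the front lengthens `F` and keeps `B`;
discarding a vertex shortens both by one; splitting leaves at least one vertex on each side. Since
|F| ≤ |B|, the measure is positive for a nonempty front. -/
theorem hasPotential_of_isFront (hT : IsTriangulation S G) (hS : NoThreeCollinear S)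
    (hgen : ∀ a ∈ S, ∀ b ∈ S, a ≠ b → orient m a b ≠ 0) (hg₁ : 1 ≤ g 1)
    (hg : ∀ m n : ℕ, 1 ≤ m → 1 ≤ n → g m * g n + 1 ≤ g (m + n)) :
    ∀ (k : ℕ) (F : List Plane) (E : Plane → Plane → Prop) (B : Finset Plane),
      IsFront S G m c E B F → F ≠ [] → 2 * B.card ≤ F.length + k →
      HasPotential (fun a b c => 0 < orient a b c) (rank m c) g E F B.card := by
  classical
  have hG := hT.toIsPlaneStraightLineGraph
  intro k
  induction k with
  | zero =>
    intro F E B h hF hk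
    exfalso
    have h1 : F.toFinset ⊆ B := fun v hv => h.mem v (List.mem_toFinset.1 hv)
    have h2 := Finset.card_le_card h1
    rw [List.toFinset_card_of_nodup h.nodup] at h2
    have := List.length_pos_iff.2 hF
    omega
  | succ k ih =>
    intro F E B h hF hk
    have hρ := h.rank_lt
    have hpw := h.pairwise
    have hE2 : ∀ y z, E y z → G.Adj y z ∧ 0 < orient m y z := fun y z hyz =>
      ⟨(h.edge y z hyz).1, (h.edge y z hyz).2.2.2⟩
    -- A hull edge on the front separates the remaining problem into independent halves.
    by_cases hhull : ∃ s u v t, F = s ++ u :: v :: t ∧ ∀ b ∈ S, 0 ≤ orient u v b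
    · obtain ⟨s, u, v, t, rfl, hb⟩ := hhull
      obtain ⟨hs, huv, ht⟩ := sorted_split hpw
      obtain ⟨hl1, hl, hl2⟩ := List.isChain_append_cons_cons.1 h.link
      have hu0 : 0 < orient m c u := h.pos_of_mem (by simp)
      have hv0 : 0 < orient m c v := h.pos_of_mem (by simp)
      set B₁ := B.filter fun b => rank m c b ≤ rank m c u with hB₁
      set B₂ := B.filter fun b => rank m c v ≤ rank m c b with hB₂
      have hms : ∀ z ∈ s ++ [u], z ∈ s ++ u :: v :: t := fun z hz => mem_split_iff.2 (Or.inl hz)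
      have hmt : ∀ z ∈ v :: t, z ∈ s ++ u :: v :: t := fun z hz => mem_split_iff.2 (Or.inr hz)
      have hdisj : Disjoint B₁ B₂ := by
        rw [Finset.disjoint_left]
        intro b h1 h2
        have := (Finset.mem_filter.1 h1).2
        have := (Finset.mem_filter.1 h2).2
        linarith
      have hcard : B₁.card + B₂.card ≤ B.card := by
        rw [← Finset.card_union_of_disjoint hdisj]
        exact Finset.card_le_card (Finset.union_subset (Finset.filter_subset _ _)
          (Finset.filter_subset _ _))
      have hf1 : IsFront S G m c E B₁ (s ++ [u]) := by
        refine ⟨fun b hb => h.subset b (Finset.mem_filter.1 hb).1, h.edge,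
          fun z hz => Finset.mem_filter.2 ⟨h.mem z (hms z hz), hs z hz⟩,
          hl1.imp_of_mem_imp fun a d _ hd had => had.mono (fun _ _ h => h) fun b hb _ h2 => ?_⟩
        refine Finset.mem_filter.2 ⟨hb, le_trans (le_of_lt ?_) (hs d hd)⟩
        exact (rank_lt_rank_iff (h.subset b hb).2 (h.pos_of_mem (hms d hd))).2 h2
      have hf2 : IsFront S G m c E B₂ (v :: t) := by
        refine ⟨fun b hb => h.subset b (Finset.mem_filter.1 hb).1, h.edge,
          fun z hz => Finset.mem_filter.2 ⟨h.mem z (hmt z hz), ht z hz⟩,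
          hl2.imp_of_mem_imp fun a d ha _ had => had.mono (fun _ _ h => h) fun b hb h1 _ => ?_⟩
        refine Finset.mem_filter.2 ⟨hb, le_trans (ht a ha) (le_of_lt ?_)⟩
        exact (rank_lt_rank_iff (h.pos_of_mem (hmt a ha)) (h.subset b hb).2).2 h1
      have hle : ∀ {B' : Finset Plane} {F' : List Plane}, IsFront S G m c E B' F' →
          F'.length ≤ B'.card := by
        intro B' F' h'
        have h1 : F'.toFinset ⊆ B' := fun v hv => h'.mem v (List.mem_toFinset.1 hv)
        have h2 := Finset.card_le_card h1
        rwa [List.toFinset_card_of_nodup h'.nodup] at h2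
      have l1 := hle hf1
      have l2 := hle hf2
      simp only [List.length_append, List.length_cons, List.length_nil] at l1 l2 hk
      have p1 := ih _ E B₁ hf1 (by simp) (by
        simp only [List.length_append, List.length_cons, List.length_nil]; omega)
      have p2 := ih _ E B₂ hf2 (by simp) (by
        simp only [List.length_cons]; omega)
      refine (HasPotential.append hρ hg₁ hpw ?_ p1 p2).mono (by exact_mod_cast hcard)
      intro y z hyz
      obtain ⟨e1, e2, e3, e4⟩ := h.edge y z hyz
      rcases hl.hull hG hS hu0 hb hyz e1 e2 e3 with h' | h' | h'
      · exact Or.inl (not_lt.1 fun hlt => absurd ((rank_lt_rank_iff hu0 e3).1 hlt) (not_lt.2 h'))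
      · exact Or.inr (Or.inl
          (not_lt.1 fun hlt => absurd ((rank_lt_rank_iff e2 hv0).1 hlt) (not_lt.2 h')))
      · exact Or.inr (Or.inr h')
    -- An apex within the angle of its edge: the front advances over the face, and the edge `u v` is
    -- handed back to the caps.
    by_cases hbet : ∃ s u v t w, F = s ++ u :: v :: t ∧ IsApex S G u v w ∧ 0 < orient m u w ∧
        0 < orient m w v
    · obtain ⟨s, u, v, t, w, rfl, hw, huw, hwv⟩ := hbet
      obtain ⟨hl1, hl, hl2⟩ := List.isChain_append_cons_cons.1 h.link
      obtain ⟨hwB, hla, hlb⟩ := hl.insert hG hE2 hw huw hwv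
      have hmono : ∀ a d, IsLink S G m E B a d →
          IsLink S G m (fun y z => E y z ∧ ¬ (y = u ∧ z = v)) B a d := fun a d had =>
        had.mono (fun _ _ h => h.1) fun b hb _ _ => hb
      refine HasPotential.add_edge (E' := fun y z => E y z ∧ ¬ (y = u ∧ z = v)) (w := w) hρ hg hpw
        (fun y z hyz => by by_cases hne : y = u ∧ z = v <;> simp [hyz, hne]) ?_
      refine ih _ _ B ⟨h.subset, fun y z hyz => h.edge y z hyz.1, ?_, ?_⟩ (by simp) ?_
      · intro z hz
        by_cases hzw : z = w
        · rwa [hzw]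
        · refine h.mem z ?_
          simp only [List.mem_append, List.mem_cons] at hz ⊢
          tauto
      · exact List.isChain_append_cons_cons.2 ⟨hl1.imp hmono, hla,
          List.isChain_cons_cons.2 ⟨hlb, hl2.imp hmono⟩⟩
      · simp only [List.length_append, List.length_cons] at hk ⊢
        omega
    -- Now every apex is off to one side of its edge, so either an end of the front can be dropped
    -- or a vertex can be bypassed.
    let P : Plane → Plane → Prop := fun u v => ∃ w, IsApex S G u v w ∧ 0 < orient m w u
    let Q : Plane → Plane → Prop := fun u v => ∃ w, IsApex S G u v w ∧ 0 < orient m v w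
    have hPQ : F.IsChain fun u v => P u v ∨ Q u v := by
      rw [List.isChain_iff_forall_rel_of_append_cons_cons]
      intro u v s t hst
      have hl := (List.isChain_iff_forall_rel_of_append_cons_cons.1 h.link) hst
      have huS := (hG.mem_of_adj u v hl.adj).1
      have hvS := (hG.mem_of_adj u v hl.adj).2
      have hnh : ¬ ∀ b ∈ S, 0 ≤ orient u v b := fun hb => hhull ⟨s, u, v, t, hst, hb⟩
      push Not at hnh
      obtain ⟨b, hb, hneg⟩ := hnh
      obtain ⟨w, hw⟩ := hT.exists_isApex hS hl.adj hb hneg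
      have hwS := (hG.mem_of_adj u w hw.adj_left).2
      rcases lt_or_gt_of_ne (hgen w hwS u huS hw.adj_left.ne') with h1 | h1
      · rcases lt_or_gt_of_ne (hgen v hvS w hwS hw.adj_right.ne) with h2 | h2
        · refine absurd ⟨s, u, v, t, w, hst, hw, ?_, ?_⟩ hbet
          · rw [orient_swap']; linarith
          · rw [orient_swap']; linarith
        · exact Or.inr ⟨w, hw, h2⟩
      · exact Or.inl ⟨w, hw, h1⟩
    match F, hF with
    | [v], _ =>
      refine (hasPotential_singleton hρ).mono ?_
      have : 0 < B.card := Finset.card_pos.2 ⟨v, h.mem v (by simp)⟩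
      exact_mod_cast this
    | a :: b :: l, _ =>
      rcases exists_first_or_last_or_switch l a b hPQ with ⟨w, hw, hwa⟩ | ⟨s, u, v, he, w, hw, hvw⟩ |
        ⟨s, u, v, x, t, he, ⟨w, hw, hvw⟩, y, hy, hyv⟩
      · have hl := (List.isChain_cons_cons.1 h.link)
        have haB : a ∈ B := h.mem a (by simp)
        have hcard := Finset.card_erase_add_one haB
        have hf : IsFront S G m c E (B.erase a) (b :: l) := by
          have hne : ∀ z ∈ b :: l, rank m c a < rank m c z := (List.pairwise_cons.1 hpw).1
          refine ⟨fun b hb => h.subset b (Finset.mem_of_mem_erase hb), h.edge, fun z hz =>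
            Finset.mem_erase.2 ⟨?_, h.mem z (by simp at hz ⊢; tauto)⟩,
            hl.2.imp_of_mem_imp fun p q hp _ hpq => hpq.mono (fun _ _ h => h) fun z hz h1 _ =>
              Finset.mem_erase.2 ⟨?_, hz⟩⟩
          · rintro rfl
            exact lt_irrefl _ (hne z hz)
          · rintro rfl
            have := (rank_lt_rank_iff (h.pos_of_mem (by simp at hp ⊢; tauto))
              (h.pos_of_mem (by simp))).2 h1
            exact lt_asymm this (hne p hp)
        have hp := ih _ E (B.erase a) hf (by simp) (by
          simp only [List.length_cons] at hk ⊢; omega)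
        have := hp.cons hρ hg₁ hpw fun z hz => hl.1.eq_of_adj_left hG hS hw hwa hz
          (hE2 a z hz).1 (hE2 a z hz).2
        refine this.mono (le_of_eq ?_)
        exact_mod_cast hcard
      · rw [he] at h hpw hk ⊢
        obtain ⟨hl1, hl, -⟩ := List.isChain_append_cons_cons.1 h.link
        obtain ⟨hs, huv, -⟩ := sorted_split hpw
        have hvB : v ∈ B := h.mem v (by simp)
        have hcard := Finset.card_erase_add_one hvB
        have hmem : ∀ z ∈ s ++ [u], z ∈ s ++ [u, v] := fun z hz => by
          simp at hz ⊢; tauto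
        have hf : IsFront S G m c E (B.erase v) (s ++ [u]) := by
          refine ⟨fun b hb => h.subset b (Finset.mem_of_mem_erase hb), h.edge, fun z hz =>
            Finset.mem_erase.2 ⟨?_, h.mem z (hmem z hz)⟩,
            hl1.imp_of_mem_imp fun p q _ hq hpq => hpq.mono (fun _ _ h => h) fun z hz _ h2 =>
              Finset.mem_erase.2 ⟨?_, hz⟩⟩
          · rintro rfl
            exact absurd (hs z hz) (not_le.2 huv)
          · rintro rfl
            have := (rank_lt_rank_iff (h.pos_of_mem (by simp)) (h.pos_of_mem (hmem q hq))).2 h2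
            have := hs q hq
            linarith
        have hp := ih _ E (B.erase v) hf (by simp) (by
          simp only [List.length_append, List.length_cons, List.length_nil] at hk ⊢; omega)
        have := hp.concat hρ hg₁ hpw fun z hz => hl.eq_of_adj_right hG hS hw hvw hz
          (hE2 z v hz).1.symm (hE2 z v hz).2
        refine this.mono (le_of_eq ?_)
        exact_mod_cast hcard
      · rw [he] at h hpw hk ⊢
        obtain ⟨hl1, hl, hl2⟩ := List.isChain_append_cons_cons.1 h.link
        obtain ⟨hl', hl3⟩ := List.isChain_cons_cons.1 hl2
        obtain ⟨hs, huv, -⟩ := sorted_split hpw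
        have hvx : rank m c v < rank m c x ∧ ∀ z ∈ x :: t, rank m c x ≤ rank m c z :=
          (sorted_split (s := s ++ [u]) (by simpa using hpw)).2
        -- The two links are sides of one face. Its third vertex is the far end of the second link,
        -- so `v` is a reflex corner of the front.
        obtain rfl := hl.apex_eq hG hS hl' hw hvw hy hyv
        have hvB : v ∈ B := h.mem v (by simp)
        have hvS : v ∈ S := (h.subset v hvB).1
        have hcard := Finset.card_erase_add_one hvB
        have hux : 0 < orient m u w :=
          (rank_lt_rank_iff (h.pos_of_mem (by simp)) (h.pos_of_mem (by simp))).1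
            (huv.trans hvx.1)
        have hby := hl.bypass hG hl' hux (fun b hb hbv => hgen v hvS b hb (Ne.symm hbv))
          (fun y z hyz => (hE2 y z hyz).1) hw
        have hnb : ∀ z, E v z ∨ E z v → z = u ∨ z = w := by
          intro z hz
          refine hl.eq_or_eq_of_adj hG hS hl' hw ?_ ?_ ?_
          · rcases hz with hz | hz
            · exact (hE2 _ _ hz).1
            · exact (hE2 _ _ hz).1.symm
          · intro p hp
            rcases hz with hz | hz
            · exact hl.free _ _ hz p hp
            · exact hl.free _ _ hz p (segment_symm ℝ v z ▸ hp)
          · intro p hp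
            rcases hz with hz | hz
            · exact hl'.free _ _ hz p hp
            · exact hl'.free _ _ hz p (segment_symm ℝ v z ▸ hp)
        have hin : ∀ z, E z v → z = u := by
          intro z hz
          refine (hnb z (Or.inr hz)).resolve_right ?_
          rintro rfl
          exact lt_asymm (hρ _ _ hz) hvx.1
        have hout : ∀ z, E v z → z = w := by
          intro z hz
          refine (hnb z (Or.inl hz)).resolve_left ?_
          rintro rfl
          exact lt_asymm (hρ _ _ hz) huv
        have hf : IsFront S G m c (fun y z => E y z ∧ y ≠ v ∧ z ≠ v) (B.erase v)
            (s ++ u :: w :: t) := by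
          refine ⟨fun b hb => h.subset b (Finset.mem_of_mem_erase hb),
            fun y z hyz => h.edge y z hyz.1, fun z hz => Finset.mem_erase.2 ⟨?_, h.mem z ?_⟩,
            List.isChain_append_cons_cons.2
              ⟨hl1.imp_of_mem_imp fun p q _ hq hpq => hpq.mono (fun _ _ h => h.1)
                fun z hz _ h2 => Finset.mem_erase.2 ⟨?_, hz⟩, hby,
              hl3.imp_of_mem_imp fun p q hp _ hpq => hpq.mono (fun _ _ h => h.1)
                fun z hz h1 _ => Finset.mem_erase.2 ⟨?_, hz⟩⟩⟩
          · rintro rfl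
            rcases mem_split_iff.1 hz with hz | hz
            · exact absurd (hs z hz) (not_le.2 huv)
            · exact absurd (hvx.2 z hz) (not_le.2 hvx.1)
          · simp only [List.mem_append, List.mem_cons] at hz ⊢
            tauto
          · rintro rfl
            have := (rank_lt_rank_iff (h.pos_of_mem (by simp))
              (h.pos_of_mem (mem_split_iff.2 (Or.inl hq)))).2 h2
            have := hs q hq
            linarith
          · rintro rfl
            have := (rank_lt_rank_iff (h.pos_of_mem (by simp at hp ⊢; tauto))
              (h.pos_of_mem (by simp))).2 h1
            have := hvx.2 p hp
            linarith [hvx.1]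
        have hp := ih _ _ (B.erase v) hf (by simp) (by
          simp only [List.length_append, List.length_cons] at hk ⊢; omega)
        have := hp.bypass hρ hg₁ hpw hin hout (not_lt.2 hw.neg.le)
          fun y z hyz hy hz => ⟨hyz, hy, hz⟩
        refine this.mono (le_of_eq ?_)
        exact_mod_cast hcard

end Induction

/-! ### The recursion for the growth function -/

section Growth

/-- The base of the exponential bound. -/
noncomputable def growthBase : ℝ := 1.502845

/-- A real majorant of the numbers of monotone paths in triangulated convex chains. -/
noncomputable def growthTail (n : ℕ) : ℝ := growthBase ^ n - 0.507 / growthBase ^ n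

/-- A solution of `g m * g n + 1 ≤ g (m + n)` of growth `growthBase`. -/
noncomputable def growth : ℕ → ℝ
  | 0 => 0
  | 1 => 1
  | 2 => 2
  | 3 => 3
  | 4 => 5
  | 5 => 7
  | 6 => 11
  | 7 => 16
  | 8 => 26
  | 9 => 36
  | n + 10 => growthTail (n + 10)

theorem growthBase_pos : 0 < growthBase := by norm_num [growthBase]

theorem one_le_growthBase_pow (n : ℕ) : 1 ≤ growthBase ^ n :=
  one_le_pow₀ (by norm_num [growthBase])

theorem growthTail_nonneg (n : ℕ) : 0 ≤ growthTail n := by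
  have h := one_le_growthBase_pow n
  rw [growthTail, sub_nonneg, div_le_iff₀ (by linarith)]
  nlinarith

theorem growth_nonneg (n : ℕ) : 0 ≤ growth n := by
  unfold growth
  split <;> first | positivity | exact growthTail_nonneg _

theorem growth_le_growthTail {n : ℕ} (hn : 1 ≤ n) : growth n ≤ growthTail n := by
  unfold growth
  split
  · omega
  all_goals first | exact le_rfl | (norm_num [growthTail, growthBase])

theorem growth_le_pow {n : ℕ} (hn : 1 ≤ n) : growth n ≤ growthBase ^ n := by
  have h := one_le_growthBase_pow n
  refine (growth_le_growthTail hn).trans ?_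
  rw [growthTail, sub_le_self_iff]
  positivity

/-- With X = b^m and Y = b^n, the correction 0.507/X contributes 0.507(X² + Y²)/(XY), at least
1.014, against the required 1. The surplus 0.014 beats the remaining 0.764049/(XY) once XY ≥ 58, and
b^10 > 58. The constant exceeds 1/2 for this reason, yet is small enough for the tail to dominate
the tabulated values, most tightly 26 at n = 8. -/
theorem growthTail_mul_add_one_le {m n : ℕ} (hmn : 10 ≤ m + n) :
    growthTail m * growthTail n + 1 ≤ growthTail (m + n) := by
  unfold growthTail
  have hX := one_le_growthBase_pow m
  have hY := one_le_growthBase_pow n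
  have hXY : 58 ≤ growthBase ^ m * growthBase ^ n := by
    rw [← pow_add]
    refine le_trans ?_ (pow_le_pow_right₀ (by norm_num [growthBase]) hmn)
    norm_num [growthBase]
  rw [pow_add]
  set X := growthBase ^ m
  set Y := growthBase ^ n
  have hX0 : 0 < X := by linarith
  have hY0 : 0 < Y := by linarith
  rw [← sub_nonneg]
  have e : X * Y - 0.507 / (X * Y) - ((X - 0.507 / X) * (Y - 0.507 / Y) + 1) =
      (0.507 * (X - Y) ^ 2 + 0.014 * (X * Y) - 0.764049) / (X * Y) := by
    field_simp
    ring
  rw [e]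
  refine div_nonneg ?_ (by positivity)
  nlinarith [sq_nonneg (X - Y)]

theorem growth_mul_add_one_le (m n : ℕ) (hm : 1 ≤ m) (hn : 1 ≤ n) :
    growth m * growth n + 1 ≤ growth (m + n) := by
  rcases lt_or_ge (m + n) 10 with h | h
  · have hm' : m < 10 := by omega
    have hn' : n < 10 := by omega
    -- The table holds the least values allowed by the recursion from g(1) = 1.
    interval_cases m <;> interval_cases n <;> first | omega | norm_num [growth]
  · obtain ⟨k, hk⟩ := Nat.exists_eq_add_of_le' h
    have e : growth (m + n) = growthTail (m + n) := by rw [hk]; rfl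
    rw [e]
    refine le_trans ?_ (growthTail_mul_add_one_le h)
    have := mul_le_mul (growth_le_growthTail hm) (growth_le_growthTail hn) (growth_nonneg n)
      (growthTail_nonneg m)
    linarith

/-- The gap between 1.502845 and 1.50285 absorbs the polynomial factor. -/
theorem isBigO_sq_mul_growthBase :
    (fun n : ℕ => (n : ℝ) ^ 2 * growthBase ^ n) =O[Filter.atTop] fun n : ℕ => (1.50285 : ℝ) ^ n := by
  have h := (isLittleO_pow_const_const_pow_of_one_lt (R := ℝ) 2
    (show (1 : ℝ) < 1.50285 / growthBase by norm_num [growthBase])).isBigO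
  have h2 := h.mul (Asymptotics.isBigO_refl (fun n : ℕ => growthBase ^ n) Filter.atTop)
  refine h2.congr_right fun n => ?_
  rw [← mul_pow, div_mul_cancel₀ _ growthBase_pos.ne']

end Growth

/-! ### Convex polygons as oriented boundary lists -/

section Polygon

variable {a b c m p q x : Plane} {S : Finset Plane} {G : SimpleGraph Plane} {H : G.Subgraph}
  {l : List Plane}

/-- A supporting functional at the midpoint of `a b` takes equal values at `a` and `b`. It is
therefore an affine function of `orient a b`, and `c` fixes the sign. -/
theorem orient_mul_nonneg_of_segment_subset_frontier {A : Set Plane} (ha : a ∈ A) (hb : b ∈ A)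
    (hc : c ∈ A) (hseg : segment ℝ a b ⊆ frontier (convexHull ℝ A)) (h : 0 < orient a b c)
    (hx : x ∈ A) : 0 ≤ orient a b x := by
  have hA := subset_convexHull ℝ A
  set μ : Plane := (1 / 2 : ℝ) • a + (1 / 2 : ℝ) • b with hμ
  have hμ' : μ ∉ interior (convexHull ℝ A) :=
    (hseg ⟨1 / 2, 1 / 2, by norm_num, by norm_num, by norm_num, rfl⟩).2
  have hint : (interior (convexHull ℝ A)).Nonempty := by
    -- The point halfway between the midpoint of `a b` and `c` is interior to the triangle `a b c`.
    refine ⟨(1 / 2 : ℝ) • μ + (1 / 2 : ℝ) • c, interior_mono (convexHull_mono ?_)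
      (mem_interior_convexHull_of_orient_pos (a := a) (b := b) (c := c) ?_ ?_ ?_)⟩
    · intro y hy
      simp only [Set.mem_insert_iff, Set.mem_singleton_iff] at hy
      rcases hy with rfl | rfl | rfl <;> assumption
    · rw [orient_combo (by norm_num), hμ, orient_combo (by norm_num)]
      simp only [orient_self_outer, orient_self_right]
      linarith
    · rw [orient_combo (by norm_num), hμ, orient_combo (by norm_num), orient_rotate a b c]
      simp only [orient_self_outer, orient_self_right]
      linarith
    · rw [orient_combo (by norm_num), hμ, orient_combo (by norm_num), orient_rotate b c a,
        orient_rotate a b c]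
      simp only [orient_self_outer, orient_self_right]
      linarith
  obtain ⟨f, hf0, hf⟩ :=
    geometric_hahn_banach_of_nonempty_interior_point (convex_convexHull ℝ A) hμ' hint
  have hfμ : f μ = (1 / 2) * f a + (1 / 2) * f b := by
    rw [hμ, map_add, map_smul, map_smul]; simp
  have h1 := hf a (hA ha)
  have h2 := hf b (hA hb)
  have hab : f b = f a := by linarith
  have key : ∀ z, orient a b c * (f z - f a) = orient a b z * (f c - f a) := by
    intro z
    have hz : orient a b c • z = orient b c z • a + orient c a z • b + orient a b z • c := by
      refine plane_ext ?_ ?_ <;>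
        simp only [PiLp.add_apply, PiLp.smul_apply, smul_eq_mul, orient] <;> ring
    have hsum : orient a b z + orient b c z + orient c a z = orient a b c := by
      unfold orient; ring
    have := congrArg f hz
    simp only [map_add, map_smul, smul_eq_mul] at this
    rw [mul_sub, this, hab, ← hsum]
    ring
  have hc' : f c < f a := by
    refine lt_of_le_of_ne (by have := hf c (hA hc); linarith) fun he => hf0 ?_
    have hz : ∀ z, f z = f a := fun z => by
      have := key z
      rw [he, sub_self, mul_zero] at this
      have := (mul_eq_zero.1 this).resolve_left h.ne'
      linarith
    ext z
    have := hz 0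
    rw [map_zero] at this
    simp [hz z, ← this]
  have hx' := hf x (hA hx)
  have := key x
  by_contra hcon
  push Not at hcon
  nlinarith [mul_pos_of_neg_of_neg hcon (sub_neg.2 hc'),
    mul_nonneg h.le (show 0 ≤ f a - f x by linarith)]

theorem IsConvexPolygon.left_of_adj (hH : IsConvexPolygon H) (hab : H.Adj a b) (hc : c ∈ H.verts)
    (h : 0 < orient a b c) (hx : x ∈ H.verts) : 0 ≤ orient a b x :=
  orient_mul_nonneg_of_segment_subset_frontier hab.fst_mem hab.snd_mem hc
    (fun _ hy => hH.2 ▸ ⟨a, b, hab, hy⟩) h hx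

/-- The list `l` runs counterclockwise around the boundary of the convex polygon `H`, from `p` to
`q`, and `q p` is an edge. -/
structure IsBoundary (H : G.Subgraph) (p q : Plane) (l : List Plane) : Prop where
  head : ∃ t, l = p :: t
  last : ∃ t, l = t ++ [q]
  nodup : l.Nodup
  length : 3 ≤ l.length
  verts : ∀ x, x ∈ H.verts ↔ x ∈ l
  adj : ∀ a b, H.Adj a b ↔ [a, b] <:+: q :: l ∨ [b, a] <:+: q :: l
  left : (q :: l).IsChain fun a b => ∀ x ∈ l, x ≠ a → x ≠ b → 0 < orient a b x

/-- This injectivity allows lists to be counted instead of polygons. -/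
theorem IsBoundary.ext {H' : G.Subgraph} (h : IsBoundary H p q l) (h' : IsBoundary H' p q l) :
    H = H' := by
  refine SimpleGraph.Subgraph.ext ?_ ?_
  · ext x; rw [h.verts, h'.verts]
  · ext a b; rw [h.adj, h'.adj]

theorem IsConvexPolygon.mem_of_mem_verts (hG : IsPlaneStraightLineGraph S G)
    (hH : IsConvexPolygon H) (hx : x ∈ H.verts) : x ∈ S := by
  obtain ⟨⟨v, w, hw, rfl⟩, -⟩ := hH
  rw [SimpleGraph.Walk.mem_verts_toSubgraph,
    SimpleGraph.Walk.mem_support_iff_exists_mem_edges_of_not_nil hw.not_nil] at hx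
  obtain ⟨e, he, hxe⟩ := hx
  have := SimpleGraph.Walk.edges_subset_edgeSet _ he
  induction e with
  | _ y z =>
    rcases Sym2.mem_iff.1 hxe with rfl | rfl
    · exact (hG.mem_of_adj _ _ this).1
    · exact (hG.mem_of_adj _ _ this).2

/-- Leftness propagates: if `c` is left of `a b`, then `a` is left of `b c`, and by convexity one
vertex on the left of an edge brings all the others. -/
theorem IsConvexPolygon.isChain_left (hS : NoThreeCollinear S) (hG : IsPlaneStraightLineGraph S G)
    (hH : IsConvexPolygon H) : ∀ (t : List Plane) (a b : Plane),
      (∀ x ∈ H.verts, x ≠ a → x ≠ b → 0 < orient a b x) → H.Adj a b → (b :: t).IsChain H.Adj →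
      (b :: t).Nodup → (∀ y ∈ t.head?, y ≠ a) →
      (a :: b :: t).IsChain fun a b => ∀ x ∈ H.verts, x ≠ a → x ≠ b → 0 < orient a b x := by
  intro t
  have hVS : ∀ {a b}, H.Adj a b → a ∈ S ∧ b ∈ S := fun h => hG.mem_of_adj _ _ h.adj_sub
  induction t with
  | nil => intro a b h _ _ _ _; simpa using h
  | cons c t ih =>
    intro a b h hab hch hnd hne
    have hca : c ≠ a := hne c (by simp)
    obtain ⟨hbc, hch'⟩ := List.isChain_cons_cons.1 hch
    have hpos : 0 < orient b c a := by
      rw [orient_rotate]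
      exact h c hbc.snd_mem hca (fun h => hbc.ne h.symm)
    refine List.isChain_cons_cons.2 ⟨h, ih b c ?_ hbc hch' (List.nodup_cons.1 hnd).2 ?_⟩
    · intro x hx hxb hxc
      refine lt_of_le_of_ne (hH.left_of_adj hbc hab.fst_mem hpos hx) (Ne.symm ?_)
      have hxS := hH.mem_of_mem_verts hG hx
      exact hS.orient_ne_zero (hVS hbc).1 (hVS hbc).2 hxS hbc.ne hxb.symm hxc.symm
    · intro y hy
      have : y ∈ c :: t := by
        cases t with
        | nil => simp at hy
        | cons z t => simp at hy; simp [hy]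
      rintro rfl
      exact (List.nodup_cons.1 hnd).1 this

theorem IsConvexPolygon.isBoundary_of_path (hS : NoThreeCollinear S)
    (hG : IsPlaneStraightLineGraph S G) (hH : IsConvexPolygon H) {u v : Plane} (h : G.Adj v u)
    (p : G.Walk u v) (hp : p.IsPath) (hlen : 2 ≤ p.length)
    (hHp : H = (SimpleGraph.Walk.cons h p).toSubgraph)
    (hpos : ∀ x ∈ H.verts, x ≠ v → x ≠ u → 0 < orient v u x) : IsBoundary H u v p.support := by
  have hadj : ∀ a b, H.Adj a b ↔ [a, b] <:+: v :: p.support ∨ [b, a] <:+: v :: p.support := by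
    intro a b
    rw [hHp, SimpleGraph.Walk.adj_toSubgraph_iff_mem_edges,
      ← SimpleGraph.Walk.infix_support_iff_mem_edges, SimpleGraph.Walk.support_cons]
  have hverts : ∀ x, x ∈ H.verts ↔ x ∈ p.support := by
    intro x
    rw [hHp, SimpleGraph.Walk.mem_verts_toSubgraph, SimpleGraph.Walk.support_cons, List.mem_cons]
    refine ⟨?_, Or.inr⟩
    rintro (rfl | hx)
    · exact p.end_mem_support
    · exact hx
  have hchain : (v :: p.support).IsChain H.Adj :=
    (List.isChain_isInfix _).imp fun a b hab => (hadj a b).2 (Or.inl hab)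
  refine ⟨⟨p.support.tail, p.cons_tail_support.symm⟩, ⟨p.support.dropLast, ?_⟩, hp.support_nodup,
    ?_, hverts, hadj, ?_⟩
  · have := List.dropLast_append_getLast p.support_ne_nil
    rw [SimpleGraph.Walk.getLast_support] at this
    exact this.symm
  · rw [SimpleGraph.Walk.length_support]; omega
  · have hnd := hp.support_nodup
    cases p with
    | nil => simp at hlen
    | @cons _ y _ h' p' =>
      rw [SimpleGraph.Walk.support_cons] at hchain hnd ⊢
      have hc := List.isChain_cons_cons.1 hchain
      refine (hH.isChain_left hS hG p'.support v u hpos hc.1 hc.2 hnd ?_).imp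
        fun a b hab x hx => hab x ((hverts x).2 (by rwa [SimpleGraph.Walk.support_cons]))
      intro z hz
      rw [← p'.cons_tail_support] at hz
      simp only [List.head?_cons, Option.mem_def, Option.some.injEq] at hz
      subst hz
      rintro rfl
      have := SimpleGraph.Walk.length_eq_zero_iff.2 (SimpleGraph.Walk.isPath_iff_nil.1 hp.of_cons)
      rw [SimpleGraph.Walk.length_cons] at hlen
      omega

theorem IsConvexPolygon.exists_isBoundary (hS : NoThreeCollinear S)
    (hG : IsPlaneStraightLineGraph S G) (hH : IsConvexPolygon H) :
    ∃ p ∈ S, ∃ q ∈ S, ∃ l, IsBoundary H p q l := by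
  obtain ⟨v, w, hw, hHw⟩ := hH.1
  cases w with
  | nil => exact absurd hw SimpleGraph.Walk.not_isCycle_nil
  | @cons _ u _ h p =>
    have hlen := hw.three_le_length
    rw [SimpleGraph.Walk.length_cons] at hlen
    have hp := ((SimpleGraph.Walk.cons_isCycle_iff p h).1 hw).1
    have hu := (hG.mem_of_adj v u h).2
    have hv := (hG.mem_of_adj v u h).1
    have hadj : H.Adj v u := by
      rw [← hHw, SimpleGraph.Walk.adj_toSubgraph_iff_mem_edges]; simp
    have hstrict : ∀ x ∈ H.verts, x ≠ v → x ≠ u → orient v u x ≠ 0 := fun x hx h1 h2 =>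
      hS.orient_ne_zero hv hu (hH.mem_of_mem_verts hG hx) h.ne h1.symm h2.symm
    by_cases hex : ∃ c ∈ H.verts, 0 < orient v u c
    · obtain ⟨c, hc, hpos⟩ := hex
      refine ⟨u, hu, v, hv, p.support, hH.isBoundary_of_path hS hG h p hp (by omega) hHw.symm ?_⟩
      exact fun x hx h1 h2 => lt_of_le_of_ne (hH.left_of_adj hadj hc hpos hx)
        (hstrict x hx h1 h2).symm
    -- The polygon lies to the right of `v u`, so the cycle is traversed backwards.
    · push Not at hex
      refine ⟨v, hv, u, hu, p.reverse.support, hH.isBoundary_of_path hS hG h.symm p.reverse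
        hp.reverse (by rw [SimpleGraph.Walk.length_reverse]; omega) ?_ ?_⟩
      · rw [← hHw]
        simp only [SimpleGraph.Walk.toSubgraph, SimpleGraph.Walk.toSubgraph_reverse]
        rw [SimpleGraph.subgraphOfAdj_symm]
      · intro x hx h1 h2
        rw [orient_swap, neg_pos]
        exact lt_of_le_of_ne (hex x hx) (hstrict x hx h2 h1)

end Polygon

/-! ### The viewpoint and the final count -/

section Count

open Filter Topology

variable {a b c m p q x : Plane} {S : Finset Plane} {G : SimpleGraph Plane} {H : G.Subgraph}
  {l : List Plane}

theorem eventually_quadratic_ne_zero {c₀ c₁ c₂ : ℝ} (h : c₀ ≠ 0 ∨ c₁ ≠ 0 ∨ c₂ ≠ 0) :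
    ∀ᶠ ε in 𝓝[>] (0 : ℝ), c₀ + ε * c₁ + ε ^ 2 * c₂ ≠ 0 := by
  by_cases h0 : c₀ = 0
  · by_cases h1 : c₁ = 0
    · have h2 : c₂ ≠ 0 := by tauto
      filter_upwards [self_mem_nhdsWithin] with ε hε
      have hε0 : ε ≠ 0 := ne_of_gt hε
      simp [h0, h1, h2, hε0]
    · have hcont : Continuous fun ε : ℝ => c₁ + ε * c₂ := by fun_prop
      have hev : ∀ᶠ ε in 𝓝 (0 : ℝ), c₁ + ε * c₂ ≠ 0 :=
        hcont.continuousAt.eventually_ne (by simpa using h1)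
      filter_upwards [self_mem_nhdsWithin, nhdsWithin_le_nhds hev] with ε hε he
      have hε0 : ε ≠ 0 := ne_of_gt hε
      have : c₀ + ε * c₁ + ε ^ 2 * c₂ = ε * (c₁ + ε * c₂) := by rw [h0]; ring
      rw [this]
      exact mul_ne_zero hε0 he
  · have hcont : Continuous fun ε : ℝ => c₀ + ε * c₁ + ε ^ 2 * c₂ := by fun_prop
    exact nhdsWithin_le_nhds (hcont.continuousAt.eventually_ne (by simpa using h0))

/-- A point close to the midpoint of `q p`, on its right side, in general position to `S`. -/
theorem exists_viewpoint (S : Finset Plane) (hpq : p ≠ q) :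
    ∃ m : Plane, orient q p m < 0 ∧ (∀ a ∈ S, ∀ b ∈ S, a ≠ b → orient m a b ≠ 0) ∧
      ∀ a ∈ S, ∀ b ∈ S, 0 < orient a b ((1 / 2 : ℝ) • q + (1 / 2 : ℝ) • p) → 0 < orient m a b := by
  set μ : Plane := (1 / 2 : ℝ) • q + (1 / 2 : ℝ) • p with hμ
  have hsq : ∀ {a b : Plane}, a ≠ b → 0 < (b 0 - a 0) ^ 2 + (b 1 - a 1) ^ 2 := by
    intro a b hab
    by_contra hn
    refine hab (plane_ext ?_ ?_) <;> nlinarith [sq_nonneg (b 0 - a 0), sq_nonneg (b 1 - a 1)]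
  -- A parabola leaving the midpoint along the right normal of `q p`. No line contains it, so for
  -- small ε > 0 it avoids each of the finitely many lines spanned by `S`.
  let v : ℝ → Plane := fun ε => !₂[μ 0 + ε * (p 1 - q 1) + ε ^ 2 * (p 0 - q 0),
    μ 1 - ε * (p 0 - q 0) + ε ^ 2 * (p 1 - q 1)]
  have hv : ∀ ε a b, orient (v ε) a b = orient a b μ +
      ε * -((b 0 - a 0) * (p 0 - q 0) + (b 1 - a 1) * (p 1 - q 1)) +
      ε ^ 2 * ((b 0 - a 0) * (p 1 - q 1) - (b 1 - a 1) * (p 0 - q 0)) := by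
    intro ε a b
    simp only [orient, v, Matrix.cons_val_zero, Matrix.cons_val_one]
    ring
  have h1 : ∀ᶠ ε in 𝓝[>] (0 : ℝ), ∀ a ∈ S, ∀ b ∈ S, a ≠ b → orient (v ε) a b ≠ 0 := by
    rw [eventually_all_finset]
    intro a _
    rw [eventually_all_finset]
    intro b _
    by_cases hab : a = b
    · simp [hab]
    have := hsq hab
    have := hsq hpq.symm
    have hne : ((b 0 - a 0) * (p 0 - q 0) + (b 1 - a 1) * (p 1 - q 1)) ^ 2 +
        ((b 0 - a 0) * (p 1 - q 1) - (b 1 - a 1) * (p 0 - q 0)) ^ 2 ≠ 0 := by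
      -- Lagrange's identity: the dot and cross products of `b - a` and `p - q` do not both vanish.
      have e : ((b 0 - a 0) * (p 0 - q 0) + (b 1 - a 1) * (p 1 - q 1)) ^ 2 +
        ((b 0 - a 0) * (p 1 - q 1) - (b 1 - a 1) * (p 0 - q 0)) ^ 2 =
        ((b 0 - a 0) ^ 2 + (b 1 - a 1) ^ 2) * ((p 0 - q 0) ^ 2 + (p 1 - q 1) ^ 2) := by ring
      rw [e]
      positivity
    have hq := eventually_quadratic_ne_zero (c₀ := orient a b μ)
      (c₁ := -((b 0 - a 0) * (p 0 - q 0) + (b 1 - a 1) * (p 1 - q 1)))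
      (c₂ := (b 0 - a 0) * (p 1 - q 1) - (b 1 - a 1) * (p 0 - q 0)) (by
        by_contra hcon
        push Not at hcon
        refine hne ?_
        rw [neg_eq_zero.1 hcon.2.1, hcon.2.2]
        ring)
    filter_upwards [hq] with ε hε _
    rwa [hv]
  have h2 : ∀ᶠ ε in 𝓝[>] (0 : ℝ), ∀ a ∈ S, ∀ b ∈ S, 0 < orient a b μ → 0 < orient (v ε) a b := by
    rw [eventually_all_finset]
    intro a _
    rw [eventually_all_finset]
    intro b _
    by_cases h0 : 0 < orient a b μ
    · have hcont : Continuous fun ε : ℝ => orient a b μ +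
          ε * -((b 0 - a 0) * (p 0 - q 0) + (b 1 - a 1) * (p 1 - q 1)) +
          ε ^ 2 * ((b 0 - a 0) * (p 1 - q 1) - (b 1 - a 1) * (p 0 - q 0)) := by fun_prop
      have hev := nhdsWithin_le_nhds (s := Set.Ioi (0 : ℝ))
        (continuousAt_const.eventually_lt (f := fun _ => (0 : ℝ)) (hcont.continuousAt (x := 0))
          (by simpa using h0))
      filter_upwards [hev] with ε hε _
      rwa [hv]
    · simp [h0]
  obtain ⟨ε, hε1, hε2, hε⟩ := (h1.and (h2.and self_mem_nhdsWithin)).exists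
  refine ⟨v ε, ?_, hε1, hε2⟩
  have hμ0 : orient q p μ = 0 := by rw [hμ, orient_combo (by norm_num)]; simp
  rw [orient_rotate (v ε) q p, hv, hμ0]
  have := hsq hpq.symm
  have hε' : 0 < ε := hε
  nlinarith [mul_pos hε' this]

theorem IsBoundary.consecutive_ne (h : IsBoundary H p q l) {s t : List Plane}
    (hl : l = s ++ a :: b :: t) : b ≠ p ∧ a ≠ q ∧ ¬ (a = p ∧ b = q) := by
  have hnd := h.nodup
  have hlen := h.length
  obtain ⟨t₁, h1⟩ := h.head
  obtain ⟨t₂, h2⟩ := h.last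
  have hb : b ≠ p := by
    rintro rfl
    cases s with
    | nil => simp at hl; rw [hl] at h1 hnd; simp at h1; simp [h1.1] at hnd
    | cons y s =>
      rw [hl] at h1 hnd
      simp at h1
      simp [h1.1] at hnd
  have ha : a ≠ q := by
    rintro rfl
    rcases List.eq_nil_or_concat t with rfl | ⟨t, y, rfl⟩
    · rw [h2] at hl
      have e : t₂ ++ [a] = (s ++ [a]) ++ [b] := by simpa using hl
      have := (List.append_inj' e (by simp)).2
      simp at this
      rw [h2] at hnd
      rw [(List.append_inj' e (by simp)).1] at hnd
      simp [List.nodup_append] at hnd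
    · have e : t₂ ++ [a] = (s ++ a :: b :: t) ++ [y] := by rw [← h2, hl]; simp
      have := (List.append_inj' e (by simp)).1
      rw [h2, this] at hnd
      simp [List.nodup_append] at hnd
  refine ⟨hb, ha, ?_⟩
  rintro ⟨rfl, rfl⟩
  have hs : s = [] := by
    cases s with
    | nil => rfl
    | cons y s =>
      exfalso
      rw [hl] at h1 hnd
      simp at h1
      simp [h1.1] at hnd
  have ht : t = [] := by
    rcases List.eq_nil_or_concat t with rfl | ⟨t, y, rfl⟩
    · rfl
    · exfalso
      have e : t₂ ++ [b] = (s ++ a :: b :: t) ++ [y] := by rw [← h2, hl]; simp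
      have := (List.append_inj' e (by simp)).1
      rw [h2, this] at hnd
      simp [List.nodup_append] at hnd
  rw [hl, hs, ht] at hlen
  simp at hlen

/-- The midpoint of the base is strictly left of every other boundary edge, and `m` is close enough
to inherit this. Hence the path from `p` to `q` advances in angle around `m`. -/
theorem IsBoundary.isCap (hG : IsPlaneStraightLineGraph S G) (h : IsBoundary H p q l)
    (hm : ∀ a ∈ S, ∀ b ∈ S,
      0 < orient a b ((1 / 2 : ℝ) • q + (1 / 2 : ℝ) • p) → 0 < orient m a b) :
    IsCap (fun a b c => 0 < orient a b c)
      (fun y z => G.Adj y z ∧ 0 ≤ orient q p y ∧ 0 ≤ orient q p z ∧ 0 < orient m y z) p q l where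
  head := h.head
  last := h.last
  turns := by
    intro s a b c t hl
    have hleft := List.isChain_iff_forall_rel_of_append_cons_cons.1 h.left
    have hnd := h.nodup
    rw [hl] at hnd
    have h1 := @hleft a b (q :: s) (c :: t) (by rw [hl]; simp)
    refine h1 c (by rw [hl]; simp) ?_ ?_ <;> rintro rfl <;>
      simp [List.nodup_append] at hnd
  chain := by
    have hp : p ∈ l := by obtain ⟨t, ht⟩ := h.head; simp [ht]
    have hq : q ∈ l := by obtain ⟨t, ht⟩ := h.last; simp [ht]
    rw [List.isChain_iff_forall_rel_of_append_cons_cons]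
    intro a b s t hl
    have ha : a ∈ l := by simp [hl]
    have hb : b ∈ l := by simp [hl]
    have hadj : H.Adj a b := (h.adj a b).2 (Or.inl ⟨q :: s, t, by rw [hl]; simp⟩)
    have hchain := List.isChain_iff_forall_rel_of_append_cons_cons.1 h.left
    have hleft := @hchain a b (q :: s) t (by rw [hl]; simp)
    have hbase : ∀ x ∈ l, 0 ≤ orient q p x := by
      intro x hx
      by_cases hxq : x = q
      · simp [hxq]
      by_cases hxp : x = p
      · simp [hxp]
      obtain ⟨t', ht'⟩ := h.head
      exact (@hchain q p [] t' (by rw [ht']; simp) x hx hxq hxp).le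
    obtain ⟨hbp, haq, hne⟩ := h.consecutive_ne hl
    have hS := hG.mem_of_adj a b hadj.adj_sub
    refine ⟨hadj.adj_sub, hbase a ha, hbase b hb, hm a hS.1 b hS.2 ?_⟩
    rw [orient_combo (by norm_num)]
    have hq' : 0 ≤ orient a b q := by
      by_cases hbq : b = q
      · simp [hbq]
      · exact (hleft q hq haq.symm (Ne.symm hbq)).le
    have hp' : 0 ≤ orient a b p := by
      by_cases hap : a = p
      · simp [hap]
      · exact (hleft p hp (Ne.symm hap) hbp.symm).le
    by_cases hap : a = p
    · have hbq : b ≠ q := fun hbq => hne ⟨hap, hbq⟩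
      have := hleft q hq haq.symm hbq.symm
      linarith
    · have := hleft p hp (Ne.symm hap) hbp.symm
      linarith

/-- The reference ray from `m` is parallel to `q p`, so every point on the polygon's side of the
base is strictly to its left. -/
theorem isFront_base (hp : p ∈ S) (hq : q ∈ S) (hpq : G.Adj p q) (hm : orient q p m < 0) :
    IsFront S G m (m + (p - q))
      (fun y z => G.Adj y z ∧ 0 ≤ orient q p y ∧ 0 ≤ orient q p z ∧ 0 < orient m y z)
      (S.filter fun b => 0 ≤ orient q p b) [p, q] := by
  have hc : ∀ x, orient m (m + (p - q)) x = orient q p x - orient q p m := by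
    intro x
    simp only [orient, PiLp.add_apply, PiLp.sub_apply]
    ring
  refine ⟨?_, ?_, ?_, List.isChain_pair.2 ⟨hpq, ?_, ?_, ?_⟩⟩
  · intro b hb
    obtain ⟨hb1, hb2⟩ := Finset.mem_filter.1 hb
    exact ⟨hb1, by rw [hc]; linarith⟩
  · rintro y z ⟨h1, h2, h3, h4⟩
    exact ⟨h1, by rw [hc]; linarith, by rw [hc]; linarith, h4⟩
  · intro v hv
    simp only [List.mem_cons, List.not_mem_nil, or_false] at hv
    rcases hv with rfl | rfl <;> simp [hp, hq]
  · rw [← orient_rotate m p q, orient_swap]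
    linarith
  · rintro y z ⟨-, h2, h3, -⟩ x hx ⟨-, -, hb⟩
    have := orient_nonneg_of_mem_segment h2 h3 hx
    rw [orient_swap] at hb
    linarith
  · intro b hb _ _ h3
    rw [orient_swap] at h3
    exact Finset.mem_filter.2 ⟨hb, by linarith⟩

theorem card_boundary_le (hT : IsTriangulation S G) (hS : NoThreeCollinear S) (p q : Plane)
    (Q : Finset (List Plane)) (hQ : ∀ l ∈ Q, ∃ H : G.Subgraph, IsBoundary H p q l) :
    (Q.card : ℝ) ≤ growthBase ^ S.card := by
  rcases Q.eq_empty_or_nonempty with rfl | ⟨l₀, hl₀⟩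
  · simpa using pow_nonneg growthBase_pos.le _
  have hG := hT.toIsPlaneStraightLineGraph
  obtain ⟨H₀, h₀⟩ := hQ l₀ hl₀
  have hqp : G.Adj q p := by
    obtain ⟨t, ht⟩ := h₀.head
    exact ((h₀.adj q p).2 (Or.inl ⟨[], t, by rw [ht]; simp⟩)).adj_sub
  obtain ⟨m, hm1, hm2, hm3⟩ := exists_viewpoint S hqp.ne'
  have hpS := (hG.mem_of_adj q p hqp).2
  have hqS := (hG.mem_of_adj q p hqp).1
  have hf := isFront_base hpS hqS hqp.symm hm1
  obtain ⟨Ψ, σ, hpot⟩ := hasPotential_of_isFront (g := growth) hT hS hm2 (by norm_num [growth])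
    growth_mul_add_one_le _ _ _ _ hf (by simp) (Nat.le_add_left _ _)
  have hp0 := hpot.pos p (by simp)
  obtain ⟨n, hn, hσ, -, hgn⟩ := List.isChain_pair.1 hpot.step
  have htot := hpot.total p (by simp) q (by simp)
  have hcount := hpot.count p (by simp) q (by simp)
    ((List.pairwise_cons.1 hf.pairwise).1 q (by simp)).le Q fun l hl => by
      obtain ⟨H, h⟩ := hQ l hl
      exact h.isCap hG hm3
  -- The single edge of the base front carries the whole size, which is less than the number of
  -- vertices on its side.
  have hnS : n ≤ S.card := by
    have := Finset.card_filter_le S fun b => 0 ≤ orient q p b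
    omega
  calc (Q.card : ℝ) ≤ Ψ q / Ψ p := hcount
    _ ≤ growth n := by rwa [div_le_iff₀ hp0]
    _ ≤ growthBase ^ n := growth_le_pow hn
    _ ≤ growthBase ^ S.card := pow_le_pow_right₀ (by norm_num [growthBase]) hnS

theorem card_convexPolygons_le (hT : IsTriangulation S G) (hS : NoThreeCollinear S)
    (K : Finset G.Subgraph) (hK : ∀ H ∈ K, IsConvexPolygon H) :
    (K.card : ℝ) ≤ (S.card : ℝ) ^ 2 * growthBase ^ S.card := by
  classical
  have hG := hT.toIsPlaneStraightLineGraph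
  have hsub : K ⊆ (S ×ˢ S).biUnion fun pq => K.filter fun H => ∃ l, IsBoundary H pq.1 pq.2 l := by
    intro H hH
    obtain ⟨p, hp, q, hq, hl⟩ := (hK H hH).exists_isBoundary hS hG
    exact Finset.mem_biUnion.2 ⟨(p, q), Finset.mem_product.2 ⟨hp, hq⟩,
      Finset.mem_filter.2 ⟨hH, hl⟩⟩
  have hcard := (Finset.card_le_card hsub).trans Finset.card_biUnion_le
  have hpair : ∀ pq ∈ S ×ˢ S, ((K.filter fun H => ∃ l, IsBoundary H pq.1 pq.2 l).card : ℝ) ≤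
      growthBase ^ S.card := by
    intro pq _
    have hch : ∀ H ∈ K.filter fun H => ∃ l, IsBoundary H pq.1 pq.2 l,
        ∃ l, IsBoundary H pq.1 pq.2 l := fun H hH => (Finset.mem_filter.1 hH).2
    choose! f hf using hch
    have hinj : Set.InjOn f (K.filter fun H => ∃ l, IsBoundary H pq.1 pq.2 l) := by
      intro H hH H' hH' he
      have h' := hf H' hH'
      rw [← he] at h'
      exact (hf H hH).ext h'
    rw [← Finset.card_image_of_injOn hinj]
    refine card_boundary_le hT hS pq.1 pq.2 _ fun l hl => ?_
    obtain ⟨H, hH, rfl⟩ := Finset.mem_image.1 hl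
    exact ⟨H, hf H hH⟩
  calc (K.card : ℝ) ≤ ∑ pq ∈ S ×ˢ S,
        ((K.filter fun H => ∃ l, IsBoundary H pq.1 pq.2 l).card : ℝ) := by exact_mod_cast hcard
    _ ≤ ∑ pq ∈ S ×ˢ S, growthBase ^ S.card := Finset.sum_le_sum hpair
    _ = _ := by rw [Finset.sum_const, Finset.card_product, nsmul_eq_mul]; push_cast; ring

/-- The uniform bound on finite families excludes an infinite one. Finiteness matters because
`Set.ncard` is 0 on infinite sets. -/
theorem finite_convexPolygons (hT : IsTriangulation S G) (hS : NoThreeCollinear S) :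
    {H : G.Subgraph | IsConvexPolygon H}.Finite := by
  by_contra hinf
  obtain ⟨K, hK, hcard⟩ := Set.Infinite.exists_subset_card_eq hinf
    (⌊(S.card : ℝ) ^ 2 * growthBase ^ S.card⌋₊ + 1)
  have h := Nat.le_floor (card_convexPolygons_le hT hS K fun H hH => hK hH)
  omega

theorem numConvexPolygons_le (hT : IsTriangulation S G) (hS : NoThreeCollinear S) :
    (numConvexPolygons G : ℝ) ≤ (S.card : ℝ) ^ 2 * growthBase ^ S.card := by
  have hfin := finite_convexPolygons hT hS
  rw [numConvexPolygons, Set.ncard_eq_toFinset_card _ hfin]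
  exact card_convexPolygons_le hT hS _ fun H hH => hfin.mem_toFinset.1 hH

end Count

theorem floor_mem_upperBounds (n : ℕ) :
    ⌊(n : ℝ) ^ 2 * growthBase ^ n⌋₊ ∈ upperBounds (convexPolygonCounts n) := by
  rintro k ⟨S, G, rfl, hS, hT, rfl⟩
  exact Nat.le_floor (numConvexPolygons_le hT hS)

end GeomTriangulation

/-- Boundedness is part of the claim because `sSup` of an unbounded set of naturals is 0, which
would empty the estimate of meaning. -/
theorem corollary1 :
    (∀ n : ℕ, 3 ≤ n → BddAbove (GeomTriangulation.convexPolygonCounts n)) ∧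
      Asymptotics.IsBigO Filter.atTop
        (fun n : ℕ => (GeomTriangulation.maxConvexPolygons n : ℝ))
        (fun n : ℕ => (1.50285 : ℝ) ^ n) := by
  refine ⟨fun n _ => ⟨_, GeomTriangulation.floor_mem_upperBounds n⟩, ?_⟩
  refine Asymptotics.IsBigO.trans (Asymptotics.IsBigO.of_bound 1 (Filter.Eventually.of_forall ?_))
    GeomTriangulation.isBigO_sq_mul_growthBase
  intro n
  have hnn : 0 ≤ (n : ℝ) ^ 2 * GeomTriangulation.growthBase ^ n :=
    mul_nonneg (sq_nonneg _) (pow_nonneg GeomTriangulation.growthBase_pos.le _)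
  rw [one_mul, Real.norm_of_nonneg (Nat.cast_nonneg _), Real.norm_of_nonneg hnn]
  -- `csSup_le'` also covers an empty set of counts, so the bound holds for every `n`.
  exact (Nat.cast_le.2 (csSup_le' (GeomTriangulation.floor_mem_upperBounds n))).trans (Nat.floor_le hnn)
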